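/- Let $N\in\mathbb N$. Let $X=\{1,-1\}^N$ be the vertex set of the hypercube $H(N,2)$, in which two vertices are adjacent when they differ in exactly one coordinate; let $\partial$ be the path-length distance and $G$ the automorphism group of this graph. Let $V$ be the complex vector space with basis $X$, with the Hermitian form $\langle\,,\rangle$ (linear in the first argument) for which $X$ is orthonormal, and put $\theta_i=\theta^*_i=N-2i$ for $0\le i\le N$. Let $G$ act on $V$ by permuting $X$ and on $V^{\otimes 3}$ by $g(u\otimes v\otimes w)=g(u)\otimes g(v)\otimes g(w)$, and let $\mathrm{Fix}(G)=\{v\in V^{\otimes 3}: g(v)=v\ \forall g\in G\}$. Fix $\varkappa\in X$. For $0\le i\le N$ define elements of $\mathrm{End}(V)$ by their action on $x\in X$: $\mathsf A_i x=\sum_{\partial(x,\xi)=i}\xi$; $\mathsf A=\mathsf A_1$ is the adjacency map, that is $\mathsf A x=\sum_{\xi\sim x}\xi$; $\mathsf A^* x=\theta^*_{\partial(x,\varkappa)}x$; $\mathsf E^*_i x=x$ if $\partial(x,\varkappa)=i$ and $\mathsf E^*_ix=0$ otherwise; $\mathsf E_i=\prod_{0\le j\le N,\,j\ne i}(\mathsf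 A-\theta_j I)/(\theta_i-\theta_j)$ is the primitive idempotent of $\mathsf A$ for the eigenvalue $\theta_i$; and $\mathsf A^*_i x=2^N\langle \mathsf E_i\varkappa,x\rangle x$. (For $N=0$ the map $\mathsf A$ is zero.) Let $T$ be the subalgebra of $\mathrm{End}(V)$ generated by $\mathsf A,\mathsf A^*$. Let $\mathcal P''_N$ be the set of integer triples $(h,i,j)$ with $0\le h,i,j\le N$, $h+i+j$ even, $h+i+j\le 2N$, $h\le i+j$, $i\le j+h$, $j\le h+i$. In $\mathfrak{sl}_4(\mathbb C)$ (traceless $4\times4$ matrices with bracket $[\varphi,\phi]=\varphi\phi-\phi\varphi$) let $$A_1=\begin{pmatrix}0&1&0&0\\1&0&0&0\\0&0&0&1\\0&0&1&0\end{pmatrix},\quad A_2=\begin{pmatrix}0&0&1&0\\0&0&0&1\\1&0&0&0\\0&1&0&0\end{pmatrix},\quad A_3=\begin{pmatrix}0&0&0&1\\0&0&1&0\\0&1&0&0\\1&0&0&0\end{pmatrix},$$ $$A_1^*=\mathrm{diag}(1,1,-1,-1),\quad A_2^*=\mathrm{diag}(1,-1,1,-1),\quad A_3^*=\mathrm{diag}(1,-1,-1,1).$$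 Define $A^{(k)},A^{*(k)}\in\mathrm{End}(V^{\otimes3})$ ($k=1,2,3$) as follows: $A^{(k)}$ applies $\mathsf A$ to the $k$th tensor factor, and for $x,y,z\in X$ the maps $A^{*(1)},A^{*(2)},A^{*(3)}$ multiply $x\otimes y\otimes z$ by $\theta^*_{\partial(y,z)},\theta^*_{\partial(z,x)},\theta^*_{\partial(x,y)}$, respectively. Let $\varepsilon:V^{\otimes3}\to\mathrm{End}(V)$ be the linear map with $\varepsilon(x\otimes y\otimes z)=2^{N/2}\delta_{x,\varkappa}e_{y,z}$ for $x,y,z\in X$, where $e_{y,z}$ sends $z\mapsto y$ and all other vertices to $0$. Then the following hold. 1. For all $(h,i,j)\in\mathcal P''_N$ the maps $\mathsf E_i\mathsf A^*_h\mathsf E_j$ and $\mathsf E^*_i\mathsf A_h\mathsf E^*_j$ lie in $T$. There are unique $\mathcal A^{(1)},\mathcal A^{(2)},\mathcal A^{(3)}\in\mathrm{End}(T)$ that, for every $(h,i,j)\in\mathcal P''_N$, multiply $\mathsf E_i\mathsf A^*_h\mathsf E_j$ by $\theta_h,\theta_i,\theta_j$, respectively; and there are unique $\mathcal A^{*(1)},\mathcal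 A^{*(2)},\mathcal A^{*(3)}\in\mathrm{End}(T)$ that, for every $(h,i,j)\in\mathcal P''_N$, multiply $\mathsf E^*_i\mathsf A_h\mathsf E^*_j$ by $\theta^*_h,\theta^*_j,\theta^*_i$, respectively. 2. $\mathrm{Fix}(G)$ becomes an $\mathfrak{sl}_4(\mathbb C)$-module on which $A_k=A^{(k)}$ and $A^*_k=A^{*(k)}$ for $k\in\{1,2,3\}$. 3. $T$ becomes an $\mathfrak{sl}_4(\mathbb C)$-module on which $A_k=\mathcal A^{(k)}$ and $A^*_k=\mathcal A^{*(k)}$ for $k\in\{1,2,3\}$. 4. For any $\mathfrak{sl}_4(\mathbb C)$-module structures on $\mathrm{Fix}(G)$ and $T$ as in 2 and 3, the restriction of $\varepsilon$ to $\mathrm{Fix}(G)$ is an isomorphism of $\mathfrak{sl}_4(\mathbb C)$-modules $\mathrm{Fix}(G)\to T$. -/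

import Mathlib

open scoped TensorProduct

noncomputable section

namespace Hypercube

/-- The vertex set `X`: the `N`-tuples of elements of `{1, -1}` (the units of `ℤ`). -/
abbrev Vertex (N : ℕ) : Type := Fin N → ℤˣ

/-- The hypercube `H(N,2)`: two vertices are adjacent when they differ in exactly one coordinate. -/
def graph (N : ℕ) : SimpleGraph (Vertex N) where
  Adj x y := ∃! i, x i ≠ y i
  symm := by
    refine ⟨?_⟩
    rintro x y ⟨i, hi, hu⟩
    exact ⟨i, hi.symm, fun j hj => hu j (Ne.symm hj)⟩
  loopless := ⟨fun x ⟨_, hi, _⟩ => hi rfl⟩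

/-- The standard module `V`: the complex vector space with basis `X`, as the space of coordinate
families `(v_x)`, `x ∈ X`. -/
abbrev V (N : ℕ) : Type := Vertex N → ℂ

/-- The basis `X` of `V`. -/
abbrev basisV (N : ℕ) : Module.Basis (Vertex N) ℂ (V N) := Pi.basisFun ℂ (Vertex N)

/-- A vertex, viewed as a basis vector of `V`. -/
abbrev vec {N : ℕ} (x : Vertex N) : V N := basisV N x

/-- The Hermitian form on `V` (linear in the first argument) for which `X` is orthonormal. -/
def herm {N : ℕ} (u v : V N) : ℂ := ∑ x : Vertex N, u x * starRingEnd ℂ (v x)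

/-- The path-length distance in `H(N,2)`. -/
abbrev dist {N : ℕ} (x y : Vertex N) : ℕ := (graph N).dist x y

/-- The numbers `N - 2i`: both the eigenvalues `θ i` of the adjacency map and the dual
eigenvalues `θ* i`. -/
def theta (N i : ℕ) : ℂ := (N : ℂ) - 2 * (i : ℂ)

open Classical in
/-- The `i`-th distance map `𝖠_i`: `x ↦ ∑ ξ` over the vertices `ξ` at distance `i` from `x`. -/
def distMap (N i : ℕ) : Module.End ℂ (V N) :=
  (basisV N).constr ℂ fun x : Vertex N =>
    ∑ ξ ∈ Finset.univ.filter (fun ξ => dist x ξ = i), vec ξ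

open Classical in
/-- The adjacency map `𝖠`: `x ↦ ∑ ξ` over the neighbours `ξ` of `x`. -/
def adjMap (N : ℕ) : Module.End ℂ (V N) :=
  (basisV N).constr ℂ fun x : Vertex N =>
    ∑ ξ ∈ Finset.univ.filter (fun ξ => (graph N).Adj x ξ), vec ξ

/-- The primitive idempotent `𝖤_i` of `𝖠` for the eigenvalue `θ i`, that is
`∏_{j ≠ i} (𝖠 - θ j) / (θ i - θ j)`, the product over `0 ≤ j ≤ N`, `j ≠ i`. -/
def primIdem (N i : ℕ) : Module.End ℂ (V N) :=
  Polynomial.aeval (adjMap N) (Lagrange.basis (Finset.range (N + 1)) (theta N) i)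

theorem theta_injective (N : ℕ) : Function.Injective (theta N) := by
  intro a b h
  have h' : (a : ℂ) = b := by
    unfold theta at h
    linear_combination (-1 / 2 : ℂ) * h
  exact_mod_cast h'

/-- `𝖤_i` is the identity on the eigenspace of `𝖠` for `θ i` and zero on the one for `θ j`,
`j ≠ i`. -/
theorem primIdem_apply {N i j : ℕ} (_hi : i ≤ N) (_hj : j ≤ N) {v : V N}
    (hv : adjMap N v = theta N j • v) : primIdem N i v = if i = j then v else 0 := by
  by_cases h0 : v = 0
  · subst h0; simp
  have hev : (adjMap N).HasEigenvector (theta N j) v :=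
    ⟨Module.End.mem_eigenspace_iff.2 hv, h0⟩
  rw [primIdem, Module.End.aeval_apply_of_hasEigenvector hev]
  split_ifs with h
  · subst h
    rw [Lagrange.eval_basis_self (theta_injective N).injOn (by simp; omega), one_smul]
  · rw [Lagrange.eval_basis_of_ne h (by simp; omega), zero_smul]

/-- The dual adjacency map `𝖠*` with respect to the vertex `κ`. -/
def dualAdjMap {N : ℕ} (κ : Vertex N) : Module.End ℂ (V N) :=
  (basisV N).constr ℂ fun x : Vertex N => theta N (dist x κ) • vec x

open Classical in
/-- `𝖤*_i`: the projection of `V` onto the span of the vertices at distance `i` from `κ`. -/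
def dualPrimIdem {N : ℕ} (κ : Vertex N) (i : ℕ) : Module.End ℂ (V N) :=
  (basisV N).constr ℂ fun x : Vertex N => if dist x κ = i then vec x else 0

/-- `𝖠*_i`: `x ↦ 2^N ⟨𝖤_i κ, x⟩ x`. -/
def dualDistMap {N : ℕ} (κ : Vertex N) (i : ℕ) : Module.End ℂ (V N) :=
  (basisV N).constr ℂ fun x : Vertex N =>
    ((2 : ℂ) ^ N * herm (primIdem N i (vec κ)) (vec x)) • vec x

/-- The subconstituent (Terwilliger) algebra `T = T(κ)`. -/
def T {N : ℕ} (κ : Vertex N) : Subalgebra ℂ (Module.End ℂ (V N)) :=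
  Algebra.adjoin ℂ {adjMap N, dualAdjMap κ}

/-- The set of triples `(h, i, j)` with `0 ≤ h, i, j ≤ N`, `h + i + j` even and at most `2N`, and
the triangle inequalities. -/
def triples (N : ℕ) : Set (ℕ × ℕ × ℕ) :=
  {p | p.1 ≤ N ∧ p.2.1 ≤ N ∧ p.2.2 ≤ N ∧
    Even (p.1 + p.2.1 + p.2.2) ∧ p.1 + p.2.1 + p.2.2 ≤ 2 * N ∧
    p.1 ≤ p.2.1 + p.2.2 ∧ p.2.1 ≤ p.2.2 + p.1 ∧ p.2.2 ≤ p.1 + p.2.1}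

/-- The defining property of `𝒜⁽¹⁾, 𝒜⁽²⁾, 𝒜⁽³⁾ ∈ End(T)`: on the elements `𝖤_i 𝖠*_h 𝖤_j` of `T`
they act as the scalars `θ h`, `θ i`, `θ j`. -/
def IsCalA {N : ℕ} (κ : Vertex N) (𝒜 : Fin 3 → Module.End ℂ (T κ)) : Prop :=
  ∀ h i j : ℕ, (h, i, j) ∈ triples N →
    ∃ hB : primIdem N i * dualDistMap κ h * primIdem N j ∈ T κ,
      ∀ k : Fin 3, 𝒜 k ⟨_, hB⟩ = theta N (![h, i, j] k) • ⟨_, hB⟩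

/-- The defining property of `𝒜*⁽¹⁾, 𝒜*⁽²⁾, 𝒜*⁽³⁾ ∈ End(T)`: on the elements `𝖤*_i 𝖠_h 𝖤*_j` of `T`
they act as the scalars `θ* h`, `θ* j`, `θ* i` (in this order). -/
def IsCalAStar {N : ℕ} (κ : Vertex N) (𝒜s : Fin 3 → Module.End ℂ (T κ)) : Prop :=
  ∀ h i j : ℕ, (h, i, j) ∈ triples N →
    ∃ hB : dualPrimIdem κ i * distMap N h * dualPrimIdem κ j ∈ T κ,
      ∀ k : Fin 3, 𝒜s k ⟨_, hB⟩ = theta N (![h, j, i] k) • ⟨_, hB⟩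

/-- `V ⊗ V ⊗ V`. -/
abbrev V3 (N : ℕ) : Type := V N ⊗[ℂ] (V N ⊗[ℂ] V N)

/-- The basis `x ⊗ y ⊗ z` of `V ⊗ V ⊗ V`, where `x, y, z ∈ X`. -/
def basis3 (N : ℕ) : Module.Basis (Vertex N × Vertex N × Vertex N) ℂ (V3 N) :=
  (basisV N).tensorProduct ((basisV N).tensorProduct (basisV N))

theorem basis3_apply {N : ℕ} (x y z : Vertex N) :
    basis3 N (x, y, z) = vec x ⊗ₜ[ℂ] (vec y ⊗ₜ[ℂ] vec z) := by
  simp only [basis3, Module.Basis.tensorProduct_apply]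

/-- The automorphism group `G` of `H(N,2)`. -/
abbrev G (N : ℕ) : Type := graph N ≃g graph N

/-- The action of `g ∈ G` on `V`, which permutes the basis `X`. -/
def actV {N : ℕ} (g : G N) : Module.End ℂ (V N) := 
  (basisV N).constr ℂ fun x : Vertex N => vec (g x)

/-- The action of `g ∈ G` on `V ⊗ V ⊗ V`. -/
def actV3 {N : ℕ} (g : G N) : Module.End ℂ (V3 N) :=
  TensorProduct.map (actV g) (TensorProduct.map (actV g) (actV g))

/-- `Fix(G)`. -/
def FixG (N : ℕ) : Submodule ℂ (V3 N) where
  carrier := {v | ∀ g : G N, actV3 g v = v}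
  zero_mem' := fun g => map_zero _
  add_mem' := fun {a b} ha hb g => by rw [map_add, ha g, hb g]
  smul_mem' := fun c a ha g => by rw [map_smul, ha g]

open Classical in
/-- The maps `A⁽¹⁾, A⁽²⁾, A⁽³⁾` on `V ⊗ V ⊗ V`: apply the adjacency map in one tensor factor. -/
def adj3 (N : ℕ) : Fin 3 → Module.End ℂ (V3 N) :=
  ![(basis3 N).constr ℂ fun p =>
      ∑ ξ ∈ Finset.univ.filter (fun ξ => (graph N).Adj p.1 ξ), basis3 N (ξ, p.2.1, p.2.2),
    (basis3 N).constr ℂ fun p =>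
      ∑ ξ ∈ Finset.univ.filter (fun ξ => (graph N).Adj p.2.1 ξ), basis3 N (p.1, ξ, p.2.2),
    (basis3 N).constr ℂ fun p =>
      ∑ ξ ∈ Finset.univ.filter (fun ξ => (graph N).Adj p.2.2 ξ), basis3 N (p.1, p.2.1, ξ)]

/-- The maps `A*⁽¹⁾, A*⁽²⁾, A*⁽³⁾` on `V ⊗ V ⊗ V`: multiply `x ⊗ y ⊗ z` by `θ*` at `∂(y,z)`,
`∂(z,x)`, `∂(x,y)`. -/
def dualAdj3 (N : ℕ) : Fin 3 → Module.End ℂ (V3 N) :=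
  ![(basis3 N).constr ℂ fun p => theta N (dist p.2.1 p.2.2) • basis3 N p,
    (basis3 N).constr ℂ fun p => theta N (dist p.2.2 p.1) • basis3 N p,
    (basis3 N).constr ℂ fun p => theta N (dist p.1 p.2.1) • basis3 N p]

open Classical in
/-- `e_{x,y} ∈ End(V)`, which sends `y ↦ x` and all other vertices to `0`. -/
def matUnit {N : ℕ} (x y : Vertex N) : Module.End ℂ (V N) :=
  (basisV N).constr ℂ fun w : Vertex N => if w = y then vec x else 0

open Classical in
/-- The linear map `ε : V ⊗ V ⊗ V → End(V)`, `x ⊗ y ⊗ z ↦ 2^{N/2} δ_{x,κ} e_{y,z}`. -/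
def eps {N : ℕ} (κ : Vertex N) : V3 N →ₗ[ℂ] Module.End ℂ (V N) :=
  (basis3 N).constr ℂ fun p =>
    if p.1 = κ then (((2 : ℝ) ^ ((N : ℝ) / 2) : ℝ) : ℂ) • matUnit p.2.1 p.2.2 else 0

attribute [local instance] LieRing.ofAssociativeRing

/-- The Lie algebra `𝔰𝔩₄(ℂ)` of traceless `4 × 4` matrices, with bracket `φ ϕ - ϕ φ`. -/
abbrev sl4 : Type := LieAlgebra.SpecialLinear.sl (Fin 4) ℂ

/-- The elements `A_1, A_2, A_3` of `𝔰𝔩₄(ℂ)`. -/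
def genA : Fin 3 → sl4 :=
  ![⟨!![0, 1, 0, 0; 1, 0, 0, 0; 0, 0, 0, 1; 0, 0, 1, 0], by
      simp [LieAlgebra.SpecialLinear.sl, Matrix.trace, Fin.sum_univ_four]⟩,
    ⟨!![0, 0, 1, 0; 0, 0, 0, 1; 1, 0, 0, 0; 0, 1, 0, 0], by
      simp [LieAlgebra.SpecialLinear.sl, Matrix.trace, Fin.sum_univ_four]⟩,
    ⟨!![0, 0, 0, 1; 0, 0, 1, 0; 0, 1, 0, 0; 1, 0, 0, 0], by
      simp [LieAlgebra.SpecialLinear.sl, Matrix.trace, Fin.sum_univ_four]⟩]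

/-- The elements `A*_1, A*_2, A*_3` of `𝔰𝔩₄(ℂ)`. -/
def genAStar : Fin 3 → sl4 :=
  ![⟨Matrix.diagonal ![1, 1, -1, -1], by
      simp [LieAlgebra.SpecialLinear.sl, Matrix.trace, Fin.sum_univ_four]⟩,
    ⟨Matrix.diagonal ![1, -1, 1, -1], by
      simp [LieAlgebra.SpecialLinear.sl, Matrix.trace, Fin.sum_univ_four]⟩,
    ⟨Matrix.diagonal ![1, -1, -1, 1], by
      simp [LieAlgebra.SpecialLinear.sl, Matrix.trace, Fin.sum_univ_four]⟩]

end Hypercube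

end

/-! Everything is identified with the symmetric tensors in $(\mathbb C^4)^{\otimes N}$, that is with
$\mathrm{Sym}^N(\mathbb C^4)$, where $\mathfrak{sl}_4$ acts by derivations. Relative to $\varkappa$,
a pair of vertices $(y,z)$ is a pair of signs in each coordinate, hence a word of length $N$ in four
letters, and `coeff` reads the matrix of an endomorphism of $V$ as a function on words. The letters
are chosen so that $A_2$ flips a coordinate of $y$, $A_3$ one of $z$, $A_1$ the same one in both,
while $A^*_1,A^*_2,A^*_3$ multiply by $\theta^*$ at
$\partial(y,z),\partial(z,\varkappa),\partial(y,\varkappa)$.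

Permutations of the coordinates relative to $\varkappa$ are automorphisms that commute with the
generators of $T$, so $T$ maps into the symmetric tensors. Conversely, the orbit of a word is
determined by its three distances (`exists_perm_of_profile_eq`), and the matrix of $\mathsf
E^*_i\mathsf A_h\mathsf E^*_j$ is the indicator of such a class, so these elements span the
symmetric tensors and lie in $T$ (`mem_T_iff`). Conjugation by the Fourier transform of the group
$X$ with identity $\varkappa$ exchanges $\mathsf A$ with $\mathsf A^*$, $\mathsf E_i$ with $\mathsf
E^*_i$ and $\mathsf A_h$ with $\mathsf A^*_h$. It therefore preserves $T$, and the $\mathsf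
E_i\mathsf A^*_h\mathsf E_j$ span $T$ too. Both families consist of eigenvectors of the generators,
which gives existence; spanning gives uniqueness.

An element of $\mathrm{Fix}(G)$ is determined by its coefficients at $\varkappa\otimes y\otimes z$,
since translations are transitive on $X$. These coefficients form, up to the scalar in
$\varepsilon$, a symmetric function on words, so $\varepsilon$ maps $\mathrm{Fix}(G)$ bijectively
onto $T$ and matches the six generators. As these generate $\mathfrak{sl}_4$ (`sl4_decomposition`),
any module structures with the prescribed generators are intertwined. -/

open scoped TensorProduct

noncomputable section

namespace Hypercube

attribute [local instance] LieRing.ofAssociativeRing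

variable {N : ℕ}

/-! ### Adjacency, distance and automorphisms of the hypercube -/

/-- The vertex obtained from `x` by changing the coordinate `i`. -/
def flip (i : Fin N) (x : Vertex N) : Vertex N := Function.update x i (-x i)

@[simp] theorem flip_same (i : Fin N) (x : Vertex N) : flip i x i = -x i := by simp [flip]

theorem flip_of_ne {i j : Fin N} (h : j ≠ i) (x : Vertex N) : flip i x j = x j := by
  simp [flip, h]

@[simp] theorem flip_flip (i : Fin N) (x : Vertex N) : flip i (flip i x) = x := by
  funext j
  by_cases h : j = i
  · subst h; simp
  · simp [flip_of_ne h]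

theorem units_ne_neg (u : ℤˣ) : u ≠ -u := by
  rcases Int.units_eq_one_or u with rfl | rfl <;> decide

theorem units_eq_neg_of_ne {u v : ℤˣ} (h : u ≠ v) : v = -u := by
  rcases Int.units_eq_one_or u with rfl | rfl <;>
    rcases Int.units_eq_one_or v with rfl | rfl <;> simp_all

theorem flip_injective (x : Vertex N) : Function.Injective fun i => flip i x := by
  intro i j h
  by_contra hij
  have := congrFun h i
  simp only [flip_same, flip_of_ne hij] at this
  exact units_ne_neg _ this.symm

theorem adj_iff_exists_flip {x ξ : Vertex N} : (graph N).Adj x ξ ↔ ∃ i, flip i x = ξ := by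
  constructor
  · rintro ⟨i, hi, hu⟩
    refine ⟨i, funext fun j => ?_⟩
    by_cases h : j = i
    · subst h; rw [flip_same, units_eq_neg_of_ne hi]
    · rw [flip_of_ne h]
      by_contra hne
      exact h (hu j hne)
  · rintro ⟨i, rfl⟩
    refine ⟨i, by simp, fun j hj => ?_⟩
    by_contra h
    exact hj (by rw [flip_of_ne h])

open Classical in
theorem sum_adj {M : Type*} [AddCommMonoid M] (x : Vertex N) (f : Vertex N → M) :
    ∑ ξ ∈ Finset.univ.filter (fun ξ => (graph N).Adj x ξ), f ξ = ∑ i, f (flip i x) := by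
  have : Finset.univ.filter (fun ξ => (graph N).Adj x ξ)
      = Finset.univ.image fun i => flip i x := by
    ext ξ; simp [adj_iff_exists_flip]
  rw [this, Finset.sum_image fun i _ j _ h => flip_injective x h]

theorem hammingDist_flip {x y : Vertex N} {i : Fin N} (h : x i ≠ y i) :
    hammingDist (flip i x) y + 1 = hammingDist x y := by
  unfold hammingDist
  have : Finset.univ.filter (fun j => flip i x j ≠ y j)
      = (Finset.univ.filter fun j => x j ≠ y j).erase i := by
    ext j
    by_cases hj : j = i
    · subst hj; simp [units_eq_neg_of_ne h]
    · simp [flip_of_ne hj, hj]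
  rw [this, Finset.card_erase_add_one (by simpa using h)]

theorem exists_walk_length_hammingDist (n : ℕ) : ∀ x y : Vertex N, hammingDist x y = n →
    ∃ p : (graph N).Walk x y, p.length = n := by
  induction n with
  | zero =>
    intro x y h
    obtain rfl := eq_of_hammingDist_eq_zero h
    exact ⟨.nil, rfl⟩
  | succ n ih =>
    intro x y h
    have hne : x ≠ y := by
      rintro rfl
      simp at h
    obtain ⟨i, hi⟩ := Function.ne_iff.1 hne
    obtain ⟨p, hp⟩ := ih (flip i x) y (by have := hammingDist_flip hi; omega)
    exact ⟨.cons (adj_iff_exists_flip.2 ⟨i, rfl⟩) p, by simp [hp]⟩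

theorem hammingDist_le_length {x y : Vertex N} (p : (graph N).Walk x y) :
    hammingDist x y ≤ p.length := by
  induction p with
  | nil => simp
  | @cons u v w h p ih =>
    obtain ⟨i, rfl⟩ := adj_iff_exists_flip.1 h
    have h1 : hammingDist u (flip i u) = 1 := by
      have := hammingDist_flip (x := u) (y := flip i u) (i := i) (by simp)
      simpa using this.symm
    have := hammingDist_triangle u (flip i u) w
    simp only [SimpleGraph.Walk.length_cons]
    omega

/-- Correcting the differing coordinates one at a time gives a walk of Hamming length, and each edge
of a walk changes the Hamming distance by at most one. -/
theorem dist_eq_hammingDist (x y : Vertex N) : dist x y = hammingDist x y := by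
  obtain ⟨p, hp⟩ := exists_walk_length_hammingDist _ x y rfl
  refine le_antisymm (hp ▸ SimpleGraph.dist_le p) ?_
  obtain ⟨q, hq⟩ := SimpleGraph.Reachable.exists_walk_length_eq_dist ⟨p⟩
  exact (hammingDist_le_length q).trans_eq hq

/-- The complex number `1` or `-1` that a unit of `ℤ` stands for. -/
def sgn (u : ℤˣ) : ℂ := ((u : ℤ) : ℂ)

@[simp] theorem sgn_one : sgn 1 = 1 := by simp [sgn]

@[simp] theorem sgn_neg (u : ℤˣ) : sgn (-u) = -sgn u := by simp [sgn]

/-- An agreeing coordinate contributes $1$ and a differing one $-1$. This additivity over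
coordinates is what makes the dual maps act by derivations. -/
theorem theta_dist (x y : Vertex N) : theta N (dist x y) = ∑ i, sgn (x i * y i) := by
  have h : ∀ i, sgn (x i * y i) = 1 - 2 * (if x i ≠ y i then 1 else 0) := by
    intro i
    rcases Int.units_eq_one_or (x i) with hx | hx <;>
      rcases Int.units_eq_one_or (y i) with hy | hy <;> simp [hx, hy] <;> norm_num
  simp_rw [h, Finset.sum_sub_distrib, ← Finset.mul_sum]
  rw [dist_eq_hammingDist]
  simp [theta, hammingDist, Finset.sum_ite]

/-- A graph automorphism preserves the distance. -/
theorem dist_iso (g : G N) (x y : Vertex N) : dist (g x) (g y) = dist x y := by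
  have key : ∀ (g : G N) (x y : Vertex N), dist (g x) (g y) ≤ dist x y := by
    intro g x y
    obtain ⟨p, hp⟩ := exists_walk_length_hammingDist _ x y rfl
    have := SimpleGraph.dist_le (p.map g.toHom)
    rw [SimpleGraph.Walk.length_map, hp, ← dist_eq_hammingDist] at this
    exact this
  refine le_antisymm (key g x y) ?_
  simpa using key g.symm (g x) (g y)

/-- Translation by a vertex, as a graph automorphism. -/
def translate (t : Vertex N) : G N where
  toEquiv := Equiv.mulLeft t
  map_rel_iff' := by
    intro x y
    simp [graph]

/-- A permutation of the coordinates that are relative to `κ`, as a graph automorphism. -/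
def permute (κ : Vertex N) (π : Equiv.Perm (Fin N)) : G N where
  toFun x i := κ i * (κ (π i) * x (π i))
  invFun x i := κ i * (κ (π.symm i) * x (π.symm i))
  left_inv x := by
    funext i
    simp [← mul_assoc, Int.units_mul_self]
  right_inv x := by
    funext i
    simp [← mul_assoc, Int.units_mul_self]
  map_rel_iff' := by
    intro x y
    simp only [graph, Equiv.coe_fn_mk, ne_eq, mul_right_inj]
    exact (π.symm.existsUnique_congr_left (p := fun i => ¬ x i = y i)).symm

@[simp] theorem translate_apply (t x : Vertex N) : translate t x = t * x := rfl

theorem permute_apply (κ : Vertex N) (π : Equiv.Perm (Fin N)) (x : Vertex N) (i : Fin N) :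
    permute κ π x i = κ i * (κ (π i) * x (π i)) := rfl

theorem permute_base (κ : Vertex N) (π : Equiv.Perm (Fin N)) : permute κ π κ = κ := by
  funext i
  simp [permute_apply, Int.units_mul_self]

/-! ### The maps on $V$ in coordinates -/

open Classical in
theorem vec_apply (x y : Vertex N) : vec x y = if y = x then 1 else 0 := by
  simp [vec, Pi.basisFun_apply, Pi.single_apply]

theorem constr_apply (F : Vertex N → V N) (v : V N) (x : Vertex N) :
    (basisV N).constr ℂ F v x = ∑ y, v y * F y x := by
  simp [Module.Basis.constr_apply_fintype]

theorem end_ext {B C : Module.End ℂ (V N)} (h : ∀ y z, B (vec z) y = C (vec z) y) : B = C :=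
  (basisV N).ext fun z => funext fun y => h y z

theorem adjMap_apply (v : V N) (x : Vertex N) : adjMap N v x = ∑ i, v (flip i x) := by
  classical
  rw [adjMap, constr_apply]
  simp_rw [sum_adj, Finset.sum_apply, Finset.mul_sum]
  rw [Finset.sum_comm]
  refine Finset.sum_congr rfl fun i _ => ?_
  rw [Finset.sum_eq_single (flip i x)]
  · simp [vec_apply]
  · intro y _ hy
    rw [vec_apply, if_neg, mul_zero]
    rintro rfl
    simp at hy
  · simp

theorem adjMap_vec (z : Vertex N) : adjMap N (vec z) = ∑ i, vec (flip i z) := by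
  classical
  rw [adjMap, Module.Basis.constr_basis, sum_adj]

theorem distMap_apply (h : ℕ) (v : V N) (x : Vertex N) [DecidablePred fun ξ => dist x ξ = h] :
    distMap N h v x = ∑ ξ with dist x ξ = h, v ξ := by
  classical
  rw [distMap, constr_apply, Finset.sum_filter]
  refine Finset.sum_congr rfl fun y _ => ?_
  simp [SimpleGraph.dist_comm]

theorem constr_smul_vec_apply (f : Vertex N → ℂ) (v : V N) (x : Vertex N) :
    (basisV N).constr ℂ (fun y => f y • vec y) v x = f x * v x := by
  rw [constr_apply, Finset.sum_eq_single x]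
  · simp [mul_comm]
  · intro y _ hy
    simp [hy.symm]
  · simp

theorem dualAdjMap_apply (κ : Vertex N) (v : V N) (x : Vertex N) :
    dualAdjMap κ v x = theta N (dist x κ) * v x := constr_smul_vec_apply _ v x

theorem dualPrimIdem_apply (κ : Vertex N) (i : ℕ) (v : V N) (x : Vertex N)
    [Decidable (dist x κ = i)] : dualPrimIdem κ i v x = if dist x κ = i then v x else 0 := by
  classical
  have := constr_smul_vec_apply (fun y : Vertex N => if dist y κ = i then (1 : ℂ) else 0) v x
  simp only [ite_smul, one_smul, zero_smul, ite_mul, one_mul, zero_mul] at this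
  rw [dualPrimIdem, this]

theorem herm_vec (v : V N) (x : Vertex N) : herm v (vec x) = v x := by
  classical
  simp [herm, vec_apply]

theorem dualDistMap_apply (κ : Vertex N) (h : ℕ) (v : V N) (x : Vertex N) :
    dualDistMap κ h v x = 2 ^ N * primIdem N h (vec κ) x * v x := by
  rw [dualDistMap, constr_smul_vec_apply, herm_vec]

theorem matUnit_apply (x y : Vertex N) (v : V N) (w : Vertex N) :
    matUnit x y v w = v y * vec x w := by
  classical
  rw [matUnit, constr_apply, Finset.sum_eq_single y]
  · simp
  · intro b _ hb
    simp [hb]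
  · simp

theorem primIdem_commute {h : ℕ} {P : Module.End ℂ (V N)} (hP : Commute P (adjMap N)) :
    Commute P (primIdem N h) := by
  have hA : adjMap N ∈ Subalgebra.centralizer ℂ {P} := by
    rw [Subalgebra.mem_centralizer_iff]
    rintro _ rfl
    exact hP
  have := (Polynomial.aeval_mem_adjoin_singleton ℂ (adjMap N)
    (p := Lagrange.basis (Finset.range (N + 1)) (theta N) h))
  have := Algebra.adjoin_le (Set.singleton_subset_iff.2 hA) this
  exact (Subalgebra.mem_centralizer_iff ℂ).1 this P rfl

theorem actV_apply (g : G N) (v : V N) (x : Vertex N) : actV g v x = v (g.symm x) := by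
  classical
  rw [actV, constr_apply, Finset.sum_eq_single (g.symm x)]
  · simp [vec_apply]
  · intro y _ hy
    rw [vec_apply, if_neg, mul_zero]
    rintro rfl
    simp at hy
  · simp

open Classical in
theorem sum_adj_iso {M : Type*} [AddCommMonoid M] (g : G N) (x : Vertex N) (f : Vertex N → M) :
    ∑ i, f (flip i (g x)) = ∑ i, f (g (flip i x)) := by
  rw [← sum_adj, ← sum_adj x fun ξ => f (g ξ)]
  symm
  refine Finset.sum_equiv g.toEquiv (fun ξ => ?_) fun _ _ => rfl
  simp [g.map_adj_iff]

theorem actV_commute (g : G N) : Commute (actV g) (adjMap N) := by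
  refine LinearMap.ext fun v => funext fun x => ?_
  simp only [Module.End.mul_apply, actV_apply, adjMap_apply]
  exact sum_adj_iso g.symm x v

theorem actV_vec (g : G N) (x : Vertex N) : actV g (vec x) = vec (g x) :=
  (basisV N).constr_basis ℂ _ x

/-! ### Characters, the Fourier transform and self-duality -/

/-- The character table of the group of order two. -/
def signTable (s t : ℤˣ) : ℂ := if s = -1 ∧ t = -1 then -1 else 1

theorem signTable_comm (s t : ℤˣ) : signTable s t = signTable t s := by
  simp [signTable, and_comm]

theorem signTable_one (s : ℤˣ) : signTable s 1 = 1 := by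
  simp [signTable, show (1 : ℤˣ) ≠ -1 by decide]

theorem signTable_neg (s t : ℤˣ) : signTable s (-t) = sgn s * signTable s t := by
  rcases Int.units_eq_one_or s with rfl | rfl <;>
    rcases Int.units_eq_one_or t with rfl | rfl <;> simp [signTable, sgn]

theorem signTable_mul (s s' t : ℤˣ) :
    signTable (s * s') t = signTable s t * signTable s' t := by
  rcases Int.units_eq_one_or s with rfl | rfl <;>
    rcases Int.units_eq_one_or s' with rfl | rfl <;>
    rcases Int.units_eq_one_or t with rfl | rfl <;> simp [signTable]

/-- The characters of the group `X`, with `κ` taken as the identity element. -/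
def character (κ x y : Vertex N) : ℂ := ∏ i, signTable (κ i * x i) (κ i * y i)

theorem character_comm (κ x y : Vertex N) : character κ x y = character κ y x := by
  simp only [character, signTable_comm]

theorem character_base (κ x : Vertex N) : character κ x κ = 1 := by
  simp [character, Int.units_mul_self, signTable_one]

/-- Only the factor at `i` changes. Summed over `i`, this makes each character an eigenvector of
$\mathsf A$. -/
theorem character_flip (κ x y : Vertex N) (i : Fin N) :
    character κ x (flip i y) = sgn (x i * κ i) * character κ x y := by
  rw [character, character, ← Finset.mul_prod_erase _ _ (Finset.mem_univ i),
    ← Finset.mul_prod_erase _ _ (Finset.mem_univ i), ← mul_assoc]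
  congr 1
  · rw [flip_same, mul_neg, signTable_neg, mul_comm (x i)]
  · refine Finset.prod_congr rfl fun j hj => ?_
    rw [flip_of_ne (Finset.ne_of_mem_erase hj)]

/-- `κ * x * x'` is the product of `x` and `x'` in the group whose identity is `κ`. -/
theorem character_mul (κ x x' y : Vertex N) :
    character κ (κ * x * x') y = character κ x y * character κ x' y := by
  simp only [character, ← Finset.prod_mul_distrib]
  refine Finset.prod_congr rfl fun i _ => ?_
  rw [← signTable_mul]
  congr 1
  simp only [Pi.mul_apply]
  rw [mul_assoc (κ i) (x i), mul_mul_mul_comm, mul_assoc]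

theorem sum_character (κ x : Vertex N) :
    ∑ y, character κ x y = if x = κ then 2 ^ N else 0 := by
  have h1 : ∑ y, character κ x y = ∏ i, ∑ t : ℤˣ, signTable (κ i * x i) (κ i * t) := by
    rw [Finset.prod_univ_sum, Fintype.piFinset_univ]
    rfl
  have h2 : ∀ i, ∑ t : ℤˣ, signTable (κ i * x i) (κ i * t) = if x i = κ i then 2 else 0 := by
    intro i
    rw [show (Finset.univ : Finset ℤˣ) = {1, -1} from rfl]
    rcases Int.units_eq_one_or (x i) with hx | hx <;>
      rcases Int.units_eq_one_or (κ i) with hk | hk <;>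
      simp [hx, hk, signTable, one_add_one_eq_two]
  rw [h1]
  simp_rw [h2]
  split_ifs with h
  · subst h; simp
  · obtain ⟨i, hi⟩ := Function.ne_iff.1 h
    exact Finset.prod_eq_zero (Finset.mem_univ i) (if_neg hi)

theorem sum_character_mul (κ x z : Vertex N) :
    ∑ y, character κ x y * character κ y z = if x = z then 2 ^ N else 0 := by
  have : ∀ y, character κ x y * character κ y z = character κ (κ * x * z) y := fun y => by
    rw [character_mul, character_comm κ y z]
  simp_rw [this, sum_character]
  congr 1
  rw [mul_assoc, mul_eq_left, eq_iff_iff]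
  constructor
  · intro h
    funext i
    have := congrFun h i
    simp only [Pi.mul_apply, Pi.one_apply] at this
    rw [← mul_one (x i), ← Int.units_mul_self (z i), ← mul_assoc, this, one_mul]
  · rintro rfl
    funext i
    simp [Int.units_mul_self]

/-- The Fourier transform of functions on `X`, with `κ` taken as the identity element. -/
def fourier (κ : Vertex N) : Module.End ℂ (V N) := Matrix.mulVecLin (Matrix.of (character κ))

theorem fourier_apply (κ : Vertex N) (v : V N) (x : Vertex N) :
    fourier κ v x = ∑ y, character κ x y * v y := rfl

theorem fourier_mul_fourier (κ : Vertex N) :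
    fourier κ * fourier κ = (2 ^ N : ℂ) • (1 : Module.End ℂ (V N)) := by
  refine LinearMap.ext fun v => funext fun x => ?_
  simp only [Module.End.mul_apply, fourier_apply, Finset.mul_sum, ← mul_assoc]
  rw [Finset.sum_comm]
  simp_rw [← Finset.sum_mul, sum_character_mul]
  simp

/-- The Fourier transform, as a linear equivalence. -/
def fourierEquiv (κ : Vertex N) : V N ≃ₗ[ℂ] V N :=
  LinearEquiv.ofLinearMap (fourier κ) ((2 ^ N : ℂ)⁻¹ • fourier κ)
    (by
      have := fourier_mul_fourier κ
      rw [Module.End.mul_eq_comp] at this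
      rw [LinearMap.comp_smul, this, smul_smul, inv_mul_cancel₀ (pow_ne_zero _ two_ne_zero), one_smul]
      rfl)
    (by
      have := fourier_mul_fourier κ
      rw [Module.End.mul_eq_comp] at this
      rw [LinearMap.smul_comp, this, smul_smul, inv_mul_cancel₀ (pow_ne_zero _ two_ne_zero), one_smul]
      rfl)

/-- Conjugation by the Fourier transform. -/
def fourierConj (κ : Vertex N) : Module.End ℂ (V N) ≃ₐ[ℂ] Module.End ℂ (V N) :=
  (fourierEquiv κ).conjAlgEquiv ℂ

theorem fourierConj_eq {κ : Vertex N} {B C : Module.End ℂ (V N)}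
    (h : fourier κ * B = C * fourier κ) : fourierConj κ B = C := by
  refine LinearMap.ext fun v => ?_
  obtain ⟨v, rfl⟩ := (fourierEquiv κ).surjective v
  have := LinearMap.congr_fun h v
  simp only [fourierConj, LinearEquiv.conjAlgEquiv_apply, LinearMap.comp_apply,
    LinearEquiv.coe_coe, LinearEquiv.symm_apply_apply]
  exact this

theorem fourier_mul (κ : Vertex N) (B : Module.End ℂ (V N)) :
    fourier κ * B = fourierConj κ B * fourier κ := by
  refine LinearMap.ext fun v => ?_
  simp only [fourierConj, LinearEquiv.conjAlgEquiv_apply, Module.End.mul_apply,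
    LinearMap.comp_apply, LinearEquiv.coe_coe]
  rw [show fourier κ v = fourierEquiv κ v from rfl, LinearEquiv.symm_apply_apply]
  rfl

/-- The square of the Fourier transform is a nonzero scalar, so conjugation by it is an involution;
each exchange below thus gives its converse. -/
theorem fourierConj_fourierConj (κ : Vertex N) (B : Module.End ℂ (V N)) :
    fourierConj κ (fourierConj κ B) = B := by
  refine fourierConj_eq ?_
  have h : (fourier κ * fourierConj κ B) * fourier κ = (B * fourier κ) * fourier κ := by
    rw [mul_assoc, ← fourier_mul, ← mul_assoc, mul_assoc B, fourier_mul_fourier]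
    simp
  refine LinearMap.ext fun v => ?_
  obtain ⟨v, rfl⟩ := (fourierEquiv κ).surjective v
  exact LinearMap.congr_fun h v

theorem fourierConj_adjMap (κ : Vertex N) : fourierConj κ (adjMap N) = dualAdjMap κ := by
  refine fourierConj_eq (LinearMap.ext fun v => funext fun x => ?_)
  simp only [Module.End.mul_apply, fourier_apply, adjMap_apply, dualAdjMap_apply, theta_dist,
    Finset.mul_sum, Finset.sum_mul]
  rw [Finset.sum_comm, Finset.sum_comm (s := Finset.univ) (t := (Finset.univ : Finset (Fin N)))]
  refine Finset.sum_congr rfl fun i _ => ?_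
  rw [← Equiv.sum_comp (Function.Involutive.toPerm _ (flip_flip i))]
  refine Finset.sum_congr rfl fun y _ => ?_
  change character κ x (flip i y) * v (flip i (flip i y)) = _
  rw [character_flip, flip_flip, mul_assoc]

theorem fourierConj_dualAdjMap (κ : Vertex N) : fourierConj κ (dualAdjMap κ) = adjMap N := by
  rw [← fourierConj_adjMap, fourierConj_fourierConj]

theorem dist_le (x y : Vertex N) : dist x y ≤ N := by
  rw [dist_eq_hammingDist]
  simpa using hammingDist_le_card_fintype (x := x) (y := y)

/-- Both families of idempotents are the same Lagrange polynomials, evaluated at $\mathsf A$ and at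
$\mathsf A^*$. -/
theorem aeval_dualAdjMap (κ : Vertex N) {i : ℕ} (hi : i ≤ N) :
    Polynomial.aeval (dualAdjMap κ) (Lagrange.basis (Finset.range (N + 1)) (theta N) i)
      = dualPrimIdem κ i := by
  classical
  refine (basisV N).ext fun x => ?_
  have hev : (dualAdjMap κ).HasEigenvector (theta N (dist x κ)) (vec x) :=
    ⟨Module.End.mem_eigenspace_iff.2 ((basisV N).constr_basis ℂ _ x), (basisV N).ne_zero x⟩
  rw [Module.End.aeval_apply_of_hasEigenvector hev, dualPrimIdem, Module.Basis.constr_basis]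
  split_ifs with h
  · rw [h, Lagrange.eval_basis_self (theta_injective N).injOn (by simp; omega), one_smul]
  · rw [Lagrange.eval_basis_of_ne (Ne.symm h) (by have := dist_le x κ; simp; omega), zero_smul]

theorem fourierConj_primIdem (κ : Vertex N) {i : ℕ} (hi : i ≤ N) :
    fourierConj κ (primIdem N i) = dualPrimIdem κ i := by
  rw [← aeval_dualAdjMap κ hi, primIdem, ← fourierConj_adjMap κ]
  exact (Polynomial.aeval_algHom_apply (fourierConj κ) _ _).symm

theorem fourierConj_dualPrimIdem (κ : Vertex N) {i : ℕ} (hi : i ≤ N) :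
    fourierConj κ (dualPrimIdem κ i) = primIdem N i := by
  rw [← fourierConj_primIdem κ hi, fourierConj_fourierConj]

theorem fourier_vec_base (κ x : Vertex N) : fourier κ (vec κ) x = 1 := by
  classical
  simp only [fourier_apply, vec_apply]
  simp [character_base]

-- The Fourier transform of $\varkappa$ is the constant function $1$, and $\mathsf E_h$ becomes the
-- projection to a sphere; transforming the indicator of that sphere back gives a sum of characters.
open Classical in
theorem two_pow_mul_primIdem_base (κ : Vertex N) {h : ℕ} (hh : h ≤ N) (y : Vertex N) :
    2 ^ N * primIdem N h (vec κ) y = ∑ z with dist κ z = h, character κ y z := by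
  have h1 : fourier κ (fourier κ (primIdem N h (vec κ))) y
      = 2 ^ N * primIdem N h (vec κ) y := by
    rw [← Module.End.mul_apply, fourier_mul_fourier]
    simp
  rw [← h1, ← Module.End.mul_apply (fourier κ) (primIdem N h), fourier_mul,
    fourierConj_primIdem κ hh, fourier_apply, Finset.sum_filter]
  refine Finset.sum_congr rfl fun z _ => ?_
  rw [Module.End.mul_apply, dualPrimIdem_apply, fourier_vec_base, dist, SimpleGraph.dist_comm]
  simp

theorem dist_translate (t x y : Vertex N) : dist (t * x) (t * y) = dist x y :=
  dist_iso (translate t) x y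

theorem vertex_mul_self (x : Vertex N) : x * x = 1 := by
  funext i
  simp [Int.units_mul_self]

/-- Multiplication by a sum of characters over the sphere about `κ` becomes a sum of translations,
which is the distance map. -/
theorem fourierConj_dualDistMap (κ : Vertex N) {h : ℕ} (hh : h ≤ N) :
    fourierConj κ (dualDistMap κ h) = distMap N h := by
  classical
  refine fourierConj_eq (LinearMap.ext fun v => funext fun x => ?_)
  simp only [Module.End.mul_apply, fourier_apply, distMap_apply, dualDistMap_apply,
    two_pow_mul_primIdem_base κ hh, Finset.mul_sum, Finset.sum_mul]
  rw [Finset.sum_comm]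
  simp_rw [Finset.sum_filter]
  -- This reindexing moves the sphere about `κ` to the sphere about `x`.
  rw [← Equiv.sum_comp (Equiv.mulLeft (κ * x))]
  refine Finset.sum_congr rfl fun z _ => ?_
  have hd : dist κ (κ * x * z) = dist x z := by
    rw [← dist_translate (κ * x), mul_right_comm, vertex_mul_self, ← mul_assoc, vertex_mul_self]
    simp
  simp only [Equiv.coe_mulLeft, hd]
  split_ifs
  · refine Finset.sum_congr rfl fun y _ => ?_
    rw [character_comm κ y, character_mul, ← mul_assoc, ← mul_assoc, ← sq]
    have : character κ x y ^ 2 = 1 := by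
      rw [sq, ← character_mul, mul_assoc, vertex_mul_self, mul_one, character_comm, character_base]
    rw [this, one_mul]
  · rfl

theorem fourierConj_distMap (κ : Vertex N) {h : ℕ} (hh : h ≤ N) :
    fourierConj κ (distMap N h) = dualDistMap κ h := by
  rw [← fourierConj_dualDistMap κ hh, fourierConj_fourierConj]

theorem map_fourierConj_T (κ : Vertex N) :
    (T κ).map (fourierConj κ : Module.End ℂ (V N) →ₐ[ℂ] Module.End ℂ (V N)) = T κ := by
  rw [T, ← Algebra.adjoin_image, Set.image_pair]
  change Algebra.adjoin ℂ {fourierConj κ (adjMap N), fourierConj κ (dualAdjMap κ)} = _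
  rw [fourierConj_adjMap, fourierConj_dualAdjMap]
  rw [Set.pair_comm]

theorem fourierConj_mem_T {κ : Vertex N} {B : Module.End ℂ (V N)} (hB : B ∈ T κ) :
    fourierConj κ B ∈ T κ := by
  rw [← map_fourierConj_T]
  exact ⟨B, hB, rfl⟩

theorem adjMap_mul_primIdem {h : ℕ} (hh : h ≤ N) :
    adjMap N * primIdem N h = theta N h • primIdem N h := by
  classical
  -- The statement does not involve a base vertex, so any choice serves for passing to the dual,
  -- diagonal identity.
  let κ : Vertex N := 1
  apply (fourierConj κ).injective
  rw [map_mul, map_smul, fourierConj_adjMap, fourierConj_primIdem κ hh]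
  refine LinearMap.ext fun v => funext fun x => ?_
  simp only [Module.End.mul_apply, dualAdjMap_apply, dualPrimIdem_apply, LinearMap.smul_apply,
    Pi.smul_apply, smul_eq_mul]
  split_ifs with h <;> simp [h]

theorem primIdem_mul_adjMap {h : ℕ} (hh : h ≤ N) :
    primIdem N h * adjMap N = theta N h • primIdem N h := by
  rw [← adjMap_mul_primIdem hh]
  exact (primIdem_commute (Commute.refl _)).eq.symm

/-! ### Symmetric tensors as an $\mathfrak{sl}_4$-module -/

/-- The functions on the `N`-tuples of elements of `Fin 4`. -/
abbrev W (N : ℕ) : Type := (Fin N → Fin 4) → ℂ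

/-- The action of a `4 × 4` matrix in the coordinate `i`. -/
def localAct (i : Fin N) : Matrix (Fin 4) (Fin 4) ℂ →ₗ[ℂ] Module.End ℂ (W N) :=
  LinearMap.mk₂ ℂ (fun φ f w => ∑ b, φ (w i) b * f (Function.update w i b))
    (fun φ ψ f => by funext w; simp [add_mul, Finset.sum_add_distrib])
    (fun c φ f => by funext w; simp [mul_assoc, Finset.mul_sum])
    (fun φ f g => by funext w; simp [mul_add, Finset.sum_add_distrib])
    (fun c φ f => by funext w; simp [mul_left_comm, Finset.mul_sum])

theorem localAct_apply (i : Fin N) (φ : Matrix (Fin 4) (Fin 4) ℂ) (f : W N) (w : Fin N → Fin 4) :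
    localAct i φ f w = ∑ b, φ (w i) b * f (Function.update w i b) := rfl

theorem localAct_mul (i : Fin N) (φ ψ : Matrix (Fin 4) (Fin 4) ℂ) :
    localAct i (φ * ψ) = localAct i φ * localAct i ψ := by
  refine LinearMap.ext fun f => funext fun w => ?_
  simp only [Module.End.mul_apply, localAct_apply, Matrix.mul_apply, Finset.sum_mul,
    Finset.mul_sum, Function.update_self, Function.update_idem, mul_assoc]
  exact Finset.sum_comm

theorem localAct_commute {i j : Fin N} (h : i ≠ j) (φ ψ : Matrix (Fin 4) (Fin 4) ℂ) :
    localAct i φ * localAct j ψ = localAct j ψ * localAct i φ := by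
  refine LinearMap.ext fun f => funext fun w => ?_
  simp only [Module.End.mul_apply, localAct_apply, Finset.mul_sum, Function.update_of_ne h,
    Function.update_of_ne h.symm]
  rw [Finset.sum_comm]
  refine Finset.sum_congr rfl fun b _ => Finset.sum_congr rfl fun c _ => ?_
  rw [Function.update_comm h, mul_left_comm]

/-- The sum over all coordinates of the action of a `4 × 4` matrix. -/
def totalAct (N : ℕ) : Matrix (Fin 4) (Fin 4) ℂ →ₗ[ℂ] Module.End ℂ (W N) := ∑ i, localAct i

theorem totalAct_apply (φ : Matrix (Fin 4) (Fin 4) ℂ) (f : W N) (w : Fin N → Fin 4) :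
    totalAct N φ f w = ∑ i, ∑ b, φ (w i) b * f (Function.update w i b) := by
  simp [totalAct, LinearMap.sum_apply, localAct_apply]

/-- In the commutator of the two sums, terms at distinct coordinates cancel because they commute; at
equal coordinates the local action is multiplicative. -/
theorem totalAct_lie (φ ψ : Matrix (Fin 4) (Fin 4) ℂ) :
    totalAct N (φ * ψ - ψ * φ)
      = totalAct N φ * totalAct N ψ - totalAct N ψ * totalAct N φ := by
  simp only [totalAct, LinearMap.sum_apply, Finset.sum_mul_sum]
  rw [Finset.sum_comm (f := fun i j => localAct i ψ * localAct j φ), ← Finset.sum_sub_distrib]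
  refine Finset.sum_congr rfl fun i _ => ?_
  rw [← Finset.sum_sub_distrib, Finset.sum_eq_single i]
  · rw [map_sub, localAct_mul, localAct_mul]
  · intro j _ hj
    rw [localAct_commute hj.symm, sub_self]
  · simp

/-- The symmetric tensors: the functions that are invariant under permutation of the
coordinates. -/
def symm (N : ℕ) : Submodule ℂ (W N) where
  carrier := {f | ∀ (π : Equiv.Perm (Fin N)) w, f (w ∘ π) = f w}
  zero_mem' := fun _ _ => rfl
  add_mem' := fun {f g} hf hg π w => by simp [hf π w, hg π w]
  smul_mem' := fun c f hf π w => by simp [hf π w]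

theorem totalAct_mem_symm (φ : Matrix (Fin 4) (Fin 4) ℂ) {f : W N} (hf : f ∈ symm N) :
    totalAct N φ f ∈ symm N := by
  intro π w
  rw [totalAct_apply, totalAct_apply,
    ← Equiv.sum_comp π fun i => ∑ b, φ (w i) b * f (Function.update w i b)]
  refine Finset.sum_congr rfl fun i _ => Finset.sum_congr rfl fun b _ => ?_
  rw [← hf π (Function.update w (π i) b)]
  congr 2
  funext j
  by_cases h : j = i
  · subst h; simp
  · simp [h]

/-- The representation of `𝔰𝔩₄(ℂ)` on the symmetric tensors. -/
def symmRep (N : ℕ) : sl4 →ₗ⁅ℂ⁆ Module.End ℂ (symm N) where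
  toFun x := (totalAct N x.1).restrict fun _ hf => totalAct_mem_symm _ hf
  map_add' x y := by
    refine LinearMap.ext fun f => Subtype.ext ?_
    simp [LinearMap.restrict_apply]
  map_smul' c x := by
    refine LinearMap.ext fun f => Subtype.ext ?_
    simp [LinearMap.restrict_apply]
  map_lie' {x y} := by
    refine LinearMap.ext fun f => Subtype.ext ?_
    exact LinearMap.congr_fun (totalAct_lie x.1 y.1) f.1

/-- The permutation of `Fin 4` with permutation matrix `A_k`. -/
def swapA : Fin 3 → Fin 4 → Fin 4 := ![![1, 0, 3, 2], ![2, 3, 0, 1], ![3, 2, 1, 0]]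

theorem totalAct_genA (k : Fin 3) (f : W N) (w : Fin N → Fin 4) :
    totalAct N (genA k).1 f w = ∑ i, f (Function.update w i (swapA k (w i))) := by
  rw [totalAct_apply]
  refine Finset.sum_congr rfl fun i _ => ?_
  generalize w i = a
  fin_cases k <;> fin_cases a <;> simp [genA, swapA, Fin.sum_univ_four]

/-- The diagonal entries of `A*_k`, as signs. -/
def signAStar : Fin 3 → Fin 4 → ℤˣ := ![![1, 1, -1, -1], ![1, -1, 1, -1], ![1, -1, -1, 1]]

theorem totalAct_genAStar (k : Fin 3) (f : W N) (w : Fin N → Fin 4) :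
    totalAct N (genAStar k).1 f w = (∑ i, sgn (signAStar k (w i))) * f w := by
  rw [totalAct_apply, Finset.sum_mul]
  refine Finset.sum_congr rfl fun i _ => ?_
  conv_rhs => rw [← Function.update_eq_self i w]
  simp only [Function.update_self]
  generalize w i = a
  fin_cases k <;> fin_cases a <;> simp [genAStar, signAStar, Matrix.diagonal]

/-! ### Endomorphisms of $V$ as functions on words -/

/-- The first vertex of the pair that a word encodes. -/
def left (κ : Vertex N) (w : Fin N → Fin 4) : Vertex N := fun i => κ i * signAStar 2 (w i)

/-- The second vertex of the pair that a word encodes. -/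
def right (κ : Vertex N) (w : Fin N → Fin 4) : Vertex N := fun i => κ i * signAStar 1 (w i)

/-- The letter that encodes a pair of signs. -/
def letter (s t : ℤˣ) : Fin 4 :=
  if s = 1 then if t = 1 then 0 else 3 else if t = 1 then 2 else 1

theorem sign_letter : ∀ s t, signAStar 2 (letter s t) = s ∧ signAStar 1 (letter s t) = t := by
  decide

theorem letter_sign : ∀ a, letter (signAStar 2 a) (signAStar 1 a) = a := by
  decide

/-- The word that encodes a pair of vertices. -/
def word (κ y z : Vertex N) : Fin N → Fin 4 := fun i => letter (κ i * y i) (κ i * z i)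

@[simp] theorem left_word (κ y z : Vertex N) : left κ (word κ y z) = y := by
  funext i
  simp [left, word, sign_letter, ← mul_assoc, Int.units_mul_self]

@[simp] theorem right_word (κ y z : Vertex N) : right κ (word κ y z) = z := by
  funext i
  simp [right, word, sign_letter, ← mul_assoc, Int.units_mul_self]

@[simp] theorem word_left_right (κ : Vertex N) (w : Fin N → Fin 4) :
    word κ (left κ w) (right κ w) = w := by
  funext i
  simp [left, right, word, letter_sign, ← mul_assoc, Int.units_mul_self]

/-- The matrix of an endomorphism of `V`, as a function on words. -/
def coeff (κ : Vertex N) : Module.End ℂ (V N) ≃ₗ[ℂ] W N where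
  toFun B w := B (vec (right κ w)) (left κ w)
  map_add' B C := rfl
  map_smul' c B := rfl
  invFun f := (basisV N).constr ℂ fun z y => f (word κ y z)
  left_inv B := end_ext fun y z => by
    rw [Module.Basis.constr_basis]
    simp
  right_inv f := by
    funext w
    change (basisV N).constr ℂ (fun z y => f (word κ y z)) (vec (right κ w)) (left κ w) = f w
    rw [Module.Basis.constr_basis]
    simp

theorem coeff_apply (κ : Vertex N) (B : Module.End ℂ (V N)) (w : Fin N → Fin 4) :
    coeff κ B w = B (vec (right κ w)) (left κ w) := rfl

theorem left_update (κ : Vertex N) (w : Fin N → Fin 4) (i : Fin N) (b : Fin 4) :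
    left κ (Function.update w i b) = Function.update (left κ w) i (κ i * signAStar 2 b) := by
  funext j
  by_cases h : j = i
  · subst h; simp [left]
  · simp [left, h]

theorem right_update (κ : Vertex N) (w : Fin N → Fin 4) (i : Fin N) (b : Fin 4) :
    right κ (Function.update w i b) = Function.update (right κ w) i (κ i * signAStar 1 b) := by
  funext j
  by_cases h : j = i
  · subst h; simp [right]
  · simp [right, h]

theorem sign_swapA : ∀ a,
    (signAStar 2 (swapA 0 a) = -signAStar 2 a ∧ signAStar 1 (swapA 0 a) = -signAStar 1 a) ∧
    (signAStar 2 (swapA 1 a) = -signAStar 2 a ∧ signAStar 1 (swapA 1 a) = signAStar 1 a) ∧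
    (signAStar 2 (swapA 2 a) = signAStar 2 a ∧ signAStar 1 (swapA 2 a) = -signAStar 1 a) := by
  decide

theorem signAStar_zero : ∀ a, signAStar 0 a = signAStar 2 a * signAStar 1 a := by decide

section
variable (κ : Vertex N) (w : Fin N → Fin 4)

theorem left_swap_zero (i : Fin N) :
    left κ (Function.update w i (swapA 0 (w i))) = flip i (left κ w) := by
  rw [left_update, (sign_swapA _).1.1, flip, mul_neg]; rfl

theorem right_swap_zero (i : Fin N) :
    right κ (Function.update w i (swapA 0 (w i))) = flip i (right κ w) := by
  rw [right_update, (sign_swapA _).1.2, flip, mul_neg]; rfl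

theorem left_swap_one (i : Fin N) :
    left κ (Function.update w i (swapA 1 (w i))) = flip i (left κ w) := by
  rw [left_update, (sign_swapA _).2.1.1, flip, mul_neg]; rfl

theorem right_swap_one (i : Fin N) :
    right κ (Function.update w i (swapA 1 (w i))) = right κ w := by
  rw [right_update, (sign_swapA _).2.1.2]
  exact Function.update_eq_self i (right κ w)

theorem left_swap_two (i : Fin N) :
    left κ (Function.update w i (swapA 2 (w i))) = left κ w := by
  rw [left_update, (sign_swapA _).2.2.1]
  exact Function.update_eq_self i (left κ w)

theorem right_swap_two (i : Fin N) :
    right κ (Function.update w i (swapA 2 (w i))) = flip i (right κ w) := by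
  rw [right_update, (sign_swapA _).2.2.2, flip, mul_neg]; rfl

theorem sum_sign_zero :
    ∑ i, sgn (signAStar 0 (w i)) = theta N (dist (left κ w) (right κ w)) := by
  simp only [theta_dist, left, right, signAStar_zero]
  refine Finset.sum_congr rfl fun i _ => ?_
  rw [mul_mul_mul_comm, Int.units_mul_self, one_mul]

theorem sum_sign_one : ∑ i, sgn (signAStar 1 (w i)) = theta N (dist (right κ w) κ) := by
  simp only [theta_dist, right]
  refine Finset.sum_congr rfl fun i _ => ?_
  rw [mul_right_comm, Int.units_mul_self, one_mul]

theorem sum_sign_two : ∑ i, sgn (signAStar 2 (w i)) = theta N (dist (left κ w) κ) := by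
  simp only [theta_dist, left]
  refine Finset.sum_congr rfl fun i _ => ?_
  rw [mul_right_comm, Int.units_mul_self, one_mul]

end

theorem totalAct_genA_one (κ : Vertex N) (B : Module.End ℂ (V N)) :
    totalAct N (genA 1).1 (coeff κ B) = coeff κ (adjMap N * B) := by
  funext w
  simp [totalAct_genA, coeff_apply, adjMap_apply, left_swap_one, right_swap_one]

theorem totalAct_genA_two (κ : Vertex N) (B : Module.End ℂ (V N)) :
    totalAct N (genA 2).1 (coeff κ B) = coeff κ (B * adjMap N) := by
  funext w
  rw [totalAct_genA, coeff_apply, Module.End.mul_apply, adjMap_vec, map_sum, Finset.sum_apply]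
  simp only [coeff_apply, left_swap_two, right_swap_two]

theorem flip_eq_translate (i : Fin N) (x : Vertex N) : flip i x = translate (flip i 1) x := by
  funext j
  by_cases h : j = i
  · subst h; simp
  · simp [flip_of_ne h]

/-- Composition of functions on `X` with the change of the coordinate `i`. -/
def flipMap (i : Fin N) : Module.End ℂ (V N) := LinearMap.funLeft ℂ ℂ (flip i)

theorem flipMap_apply (i : Fin N) (v : V N) (x : Vertex N) : flipMap i v x = v (flip i x) := rfl

theorem flipMap_vec (i : Fin N) (x : Vertex N) : flipMap i (vec x) = vec (flip i x) := by
  classical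
  funext y
  rw [flipMap_apply, vec_apply, vec_apply]
  exact if_congr ⟨fun h => by rw [← h, flip_flip], fun h => by rw [h, flip_flip]⟩ rfl rfl

theorem flipMap_commute (i : Fin N) : Commute (flipMap i) (adjMap N) := by
  refine LinearMap.ext fun v => funext fun x => ?_
  simp only [Module.End.mul_apply, flipMap_apply, adjMap_apply]
  rw [flip_eq_translate i x]
  simp_rw [fun y => flip_eq_translate i (flip y x)]
  exact sum_adj_iso (translate (flip i 1)) x v

/-- $A_1$ flips the row and column index together, which is conjugation by a coordinate flip. -/
theorem totalAct_genA_zero (κ : Vertex N) (B : Module.End ℂ (V N)) :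
    totalAct N (genA 0).1 (coeff κ B) = coeff κ (∑ i, flipMap i * B * flipMap i) := by
  funext w
  simp [totalAct_genA, coeff_apply, left_swap_zero, right_swap_zero, flipMap_apply, flipMap_vec,
    -Pi.basisFun_apply]

/-- On diagonal maps, summing the flip conjugates applies $\mathsf A$ to the diagonal, here a
multiple of the eigenvector $\mathsf E_h\varkappa$. -/
theorem sum_flipMap_dualDistMap (κ : Vertex N) {h : ℕ} (hh : h ≤ N) :
    ∑ i, flipMap i * dualDistMap κ h * flipMap i = theta N h • dualDistMap κ h := by
  refine LinearMap.ext fun v => funext fun x => ?_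
  have := congrFun (LinearMap.congr_fun (adjMap_mul_primIdem hh) (vec κ)) x
  rw [Module.End.mul_apply, adjMap_apply, LinearMap.smul_apply, Pi.smul_apply, smul_eq_mul] at this
  simp only [LinearMap.sum_apply, Finset.sum_apply, Module.End.mul_apply, flipMap_apply,
    dualDistMap_apply, flip_flip, LinearMap.smul_apply, Pi.smul_apply, smul_eq_mul]
  rw [← Finset.sum_mul, ← Finset.mul_sum, this]
  ring

/-- For $A_1$ the flips commute with $\mathsf A$, hence pass through the outer idempotents to the
middle factor. For $A_2$ and $A_3$ the factor $\mathsf A$ is absorbed by the adjacent idempotent. -/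
theorem totalAct_genA_basis (κ : Vertex N) {h i j : ℕ} (hh : h ≤ N) (hi : i ≤ N) (hj : j ≤ N)
    (k : Fin 3) :
    totalAct N (genA k).1 (coeff κ (primIdem N i * dualDistMap κ h * primIdem N j))
      = theta N (![h, i, j] k) • coeff κ (primIdem N i * dualDistMap κ h * primIdem N j) := by
  rw [← map_smul]
  fin_cases k
  · simp only [Fin.zero_eta, Fin.isValue, totalAct_genA_zero, Matrix.cons_val_zero]
    congr 1
    rw [← smul_mul_assoc, ← mul_smul_comm, ← sum_flipMap_dualDistMap κ hh, Finset.mul_sum,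
      Finset.sum_mul]
    refine Finset.sum_congr rfl fun l _ => ?_
    have h1 := (primIdem_commute (h := i) (flipMap_commute l)).eq
    have h2 := (primIdem_commute (h := j) (flipMap_commute l)).eq
    simp only [mul_assoc]
    rw [← h2]
    simp only [← mul_assoc]
    rw [h1]
  · simp only [Fin.mk_one, Fin.isValue, totalAct_genA_one, Matrix.cons_val_one,
      Matrix.cons_val_zero]
    rw [← mul_assoc, ← mul_assoc, adjMap_mul_primIdem hi, smul_mul_assoc, smul_mul_assoc]
  · simp only [Fin.reduceFinMk, Fin.isValue, totalAct_genA_two, Matrix.cons_val]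
    rw [mul_assoc, primIdem_mul_adjMap hj, mul_smul_comm]

open Classical in
theorem coeff_dualPrimIdem_mul (κ : Vertex N) (h i j : ℕ) (w : Fin N → Fin 4) :
    coeff κ (dualPrimIdem κ i * distMap N h * dualPrimIdem κ j) w
      = if dist (left κ w) (right κ w) = h ∧ dist (left κ w) κ = i ∧ dist (right κ w) κ = j
        then 1 else 0 := by
  have h1 : distMap N h (vec (right κ w)) (left κ w)
      = if dist (left κ w) (right κ w) = h then 1 else 0 := by
    rw [distMap_apply, Finset.sum_filter, Finset.sum_eq_single (right κ w)]
    · simp [vec_apply, -Pi.basisFun_apply]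
    · intro b _ hb
      simp [vec_apply, hb, -Pi.basisFun_apply]
    · simp
  rw [coeff_apply, mul_assoc, Module.End.mul_apply, dualPrimIdem_apply, Module.End.mul_apply,
    dualPrimIdem, Module.Basis.constr_basis]
  by_cases hj : dist (right κ w) κ = j
  · rw [if_pos hj, h1]
    by_cases hi : dist (left κ w) κ = i <;> simp [hi, hj]
  · rw [if_neg hj]
    simp [hj]

theorem totalAct_genAStar_basis (κ : Vertex N) (h i j : ℕ) (k : Fin 3) :
    totalAct N (genAStar k).1 (coeff κ (dualPrimIdem κ i * distMap N h * dualPrimIdem κ j))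
      = theta N (![h, j, i] k) • coeff κ (dualPrimIdem κ i * distMap N h * dualPrimIdem κ j) := by
  classical
  funext w
  rw [totalAct_genAStar, Pi.smul_apply, coeff_dualPrimIdem_mul]
  split_ifs with hw
  · obtain ⟨rfl, rfl, rfl⟩ := hw
    fin_cases k
    · simp [sum_sign_zero κ]
    · simp [sum_sign_one κ]
    · simp [sum_sign_two κ]
  · simp

/-! ### Orbits of words and the description of $T$ -/

/-- The number of occurrences of a letter in a word. -/
def count (w : Fin N → Fin 4) (a : Fin 4) : ℕ := (Finset.univ.filter fun i => w i = a).card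

theorem card_filter_letter (w : Fin N → Fin 4) (p : Fin 4 → Prop) [DecidablePred p] :
    (Finset.univ.filter fun i => p (w i)).card = ∑ a, if p a then count w a else 0 := by
  have h : (Finset.univ.filter fun i => p (w i)).card
      = ∑ a, ((Finset.univ.filter fun i => p (w i)).filter fun i => w i = a).card :=
    Finset.card_eq_sum_card_fiberwise fun _ _ => Finset.mem_univ _
  rw [h]
  refine Finset.sum_congr rfl fun a _ => ?_
  rw [Finset.filter_filter]
  split_ifs with ha
  · refine congrArg Finset.card (Finset.filter_congr fun i _ => ?_)
    exact ⟨fun h => h.2, fun h => ⟨h ▸ ha, h⟩⟩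
  · rw [Finset.card_eq_zero, Finset.filter_eq_empty_iff]
    rintro i - ⟨h1, rfl⟩
    exact ha h1

theorem sum_count (w : Fin N → Fin 4) : count w 0 + count w 1 + count w 2 + count w 3 = N := by
  have := card_filter_letter w fun _ => True
  simp only [Finset.filter_true, Finset.card_univ, Fintype.card_fin, if_true,
    Fin.sum_univ_four] at this
  exact this.symm

theorem dist_left_right (κ : Vertex N) (w : Fin N → Fin 4) :
    dist (left κ w) (right κ w) = count w 2 + count w 3 := by
  have := card_filter_letter w fun a => signAStar 2 a ≠ signAStar 1 a
  rw [dist_eq_hammingDist, hammingDist]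
  simp only [left, right, ne_eq, mul_right_inj]
  rw [this]
  simp [Fin.sum_univ_four, signAStar, show (1 : ℤˣ) ≠ -1 by decide, show (-1 : ℤˣ) ≠ 1 by decide]

theorem dist_left (κ : Vertex N) (w : Fin N → Fin 4) :
    dist (left κ w) κ = count w 1 + count w 2 := by
  have := card_filter_letter w fun a => signAStar 2 a ≠ 1
  rw [dist_eq_hammingDist, hammingDist]
  simp only [left, ne_eq, mul_eq_left]
  rw [this]
  simp [Fin.sum_univ_four, signAStar, show (-1 : ℤˣ) ≠ 1 by decide]

theorem dist_right (κ : Vertex N) (w : Fin N → Fin 4) :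
    dist (right κ w) κ = count w 1 + count w 3 := by
  have := card_filter_letter w fun a => signAStar 1 a ≠ 1
  rw [dist_eq_hammingDist, hammingDist]
  simp only [right, ne_eq, mul_eq_left]
  rw [this]
  simp [Fin.sum_univ_four, signAStar, show (-1 : ℤˣ) ≠ 1 by decide]

/-- The three distances between `κ` and the vertices that a word encodes. -/
def profile (κ : Vertex N) (w : Fin N → Fin 4) : ℕ × ℕ × ℕ :=
  (dist (left κ w) (right κ w), dist (left κ w) κ, dist (right κ w) κ)

/-- With $c_a$ the letter counts, the distances are $c_2+c_3$, $c_1+c_2$, $c_1+c_3$: their sum is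
$2(c_1+c_2+c_3)$, and each triangle defect is some $2c_a$. -/
theorem profile_mem_triples (κ : Vertex N) (w : Fin N → Fin 4) : profile κ w ∈ triples N := by
  have := sum_count w
  simp only [profile, triples, Set.mem_ofPred_eq, dist_left_right, dist_left, dist_right]
  refine ⟨by omega, by omega, by omega, ⟨count w 1 + count w 2 + count w 3, by omega⟩,
    by omega, by omega, by omega, by omega⟩

/-- The three distances and the total $N$ determine all four letter counts, and words with equal
counts differ by a permutation that matches their fibres. -/
theorem exists_perm_of_profile_eq {κ : Vertex N} {w w' : Fin N → Fin 4}
    (h : profile κ w = profile κ w') : ∃ π : Equiv.Perm (Fin N), w ∘ π = w' := by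
  have hc : ∀ a, count w' a = count w a := by
    have h1 := sum_count w
    have h2 := sum_count w'
    simp only [profile, dist_left_right, dist_left, dist_right, Prod.mk.injEq] at h
    intro a
    fin_cases a <;> simp <;> omega
  have e : ∀ a, Nonempty ({i // w' i = a} ≃ {i // w i = a}) := fun a => by
    rw [← Fintype.card_eq, Fintype.card_subtype, Fintype.card_subtype]
    exact hc a
  exact ⟨Equiv.ofFiberEquiv fun a => (e a).some, funext fun i => Equiv.ofFiberEquiv_map _ i⟩

theorem permute_left (κ : Vertex N) (π : Equiv.Perm (Fin N)) (w : Fin N → Fin 4) :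
    permute κ π (left κ w) = left κ (w ∘ π) := by
  funext i
  simp [permute_apply, left, ← mul_assoc, Int.units_mul_self]

theorem permute_right (κ : Vertex N) (π : Equiv.Perm (Fin N)) (w : Fin N → Fin 4) :
    permute κ π (right κ w) = right κ (w ∘ π) := by
  funext i
  simp [permute_apply, right, ← mul_assoc, Int.units_mul_self]

theorem actV_commute_dualAdjMap {κ : Vertex N} {g : G N} (hg : g κ = κ) :
    Commute (actV g) (dualAdjMap κ) := by
  refine LinearMap.ext fun v => funext fun x => ?_
  simp only [Module.End.mul_apply, actV_apply, dualAdjMap_apply]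
  rw [← dist_iso g, hg, RelIso.apply_symm_apply]

theorem coeff_mem_symm {κ : Vertex N} {B : Module.End ℂ (V N)} (hB : B ∈ T κ) :
    coeff κ B ∈ symm N := by
  intro π w
  have hc : Commute (actV (permute κ π)) B := by
    have hle : T κ ≤ Subalgebra.centralizer ℂ {actV (permute κ π)} := by
      refine Algebra.adjoin_le ?_
      rintro C (rfl | rfl) <;> rw [SetLike.mem_coe, Subalgebra.mem_centralizer_iff] <;>
        rintro _ rfl
      · exact actV_commute _
      · exact actV_commute_dualAdjMap (permute_base κ π)
    exact (Subalgebra.mem_centralizer_iff ℂ).1 (hle hB) _ rfl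
  rw [coeff_apply, ← permute_left, ← permute_right, ← actV_vec, ← Module.End.mul_apply, ← hc.eq,
    Module.End.mul_apply, actV_apply, RelIso.symm_apply_apply]
  rfl

theorem dualPrimIdem_mem_T (κ : Vertex N) {i : ℕ} (hi : i ≤ N) : dualPrimIdem κ i ∈ T κ := by
  rw [← aeval_dualAdjMap κ hi]
  exact Algebra.adjoin_mono (by simp) (Polynomial.aeval_mem_adjoin_singleton ℂ (dualAdjMap κ))

/-- $\mathsf E_h$ commutes with the automorphisms fixing `κ`, and these are transitive on each
sphere about `κ`. -/
theorem primIdem_base_factorsThrough (κ : Vertex N) (h : ℕ) :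
    Function.FactorsThrough (primIdem N h (vec κ)) fun x => dist x κ := by
  intro x y hxy
  obtain ⟨π, hπ⟩ : ∃ π : Equiv.Perm (Fin N), word κ x κ ∘ π = word κ y κ :=
    exists_perm_of_profile_eq (κ := κ) (by simpa [profile] using hxy)
  have hg : permute κ π x = y := by
    have := permute_left κ π (word κ x κ)
    rwa [hπ, left_word, left_word] at this
  have := congrFun (LinearMap.congr_fun
    (primIdem_commute (h := h) (actV_commute (permute κ π))).eq (vec κ)) y
  rw [Module.End.mul_apply, Module.End.mul_apply, actV_vec, permute_base, actV_apply,
    ← hg, RelIso.symm_apply_apply, hg] at this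
  exact this

theorem dualDistMap_mem_T (κ : Vertex N) (h : ℕ) : dualDistMap κ h ∈ T κ := by
  classical
  obtain ⟨F, hF⟩ := (Function.factorsThrough_iff _).1 (primIdem_base_factorsThrough κ h)
  have : dualDistMap κ h
      = ∑ i ∈ Finset.range (N + 1), (2 ^ N * F i) • dualPrimIdem κ i := by
    refine LinearMap.ext fun v => funext fun x => ?_
    rw [dualDistMap_apply, hF]
    have := dist_le x κ
    simp only [LinearMap.sum_apply, Finset.sum_apply, LinearMap.smul_apply, Pi.smul_apply,
      dualPrimIdem_apply, smul_eq_mul, mul_ite, mul_zero, Finset.sum_ite_eq, Finset.mem_range,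
      Function.comp_apply]
    rw [if_pos (by omega)]
  rw [this]
  exact Subalgebra.sum_mem _ fun i hi => Subalgebra.smul_mem _
    (dualPrimIdem_mem_T κ (by simpa [Nat.lt_succ_iff] using hi)) _

/-- $\mathsf A^*_h$ is diagonal and constant on spheres, so it lies in $T$; Fourier conjugation
preserves $T$ and carries it to $\mathsf A_h$. -/
theorem distMap_mem_T (κ : Vertex N) {h : ℕ} (hh : h ≤ N) : distMap N h ∈ T κ := by
  rw [← fourierConj_dualDistMap κ hh]
  exact fourierConj_mem_T (dualDistMap_mem_T κ h)

/-- The map `𝖤*_i 𝖠_h 𝖤*_j`. -/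
def starElt (κ : Vertex N) (t : ℕ × ℕ × ℕ) : Module.End ℂ (V N) :=
  dualPrimIdem κ t.2.1 * distMap N t.1 * dualPrimIdem κ t.2.2

/-- The map `𝖤_i 𝖠*_h 𝖤_j`. -/
def elt (κ : Vertex N) (t : ℕ × ℕ × ℕ) : Module.End ℂ (V N) :=
  primIdem N t.2.1 * dualDistMap κ t.1 * primIdem N t.2.2

theorem starElt_mem_T (κ : Vertex N) {t : ℕ × ℕ × ℕ} (ht : t ∈ triples N) : starElt κ t ∈ T κ :=
  mul_mem (mul_mem (dualPrimIdem_mem_T κ ht.2.1) (distMap_mem_T κ ht.1))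
    (dualPrimIdem_mem_T κ ht.2.2.1)

theorem fourierConj_starElt (κ : Vertex N) {t : ℕ × ℕ × ℕ} (ht : t ∈ triples N) :
    fourierConj κ (starElt κ t) = elt κ t := by
  rw [starElt, elt, map_mul, map_mul, fourierConj_dualPrimIdem κ ht.2.1,
    fourierConj_dualPrimIdem κ ht.2.2.1, fourierConj_distMap κ ht.1]

theorem elt_mem_T (κ : Vertex N) {t : ℕ × ℕ × ℕ} (ht : t ∈ triples N) : elt κ t ∈ T κ := by
  rw [← fourierConj_starElt κ ht]
  exact fourierConj_mem_T (starElt_mem_T κ ht)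

/-- A symmetric function factors through the profile, so it is a combination of indicators of
profile classes. -/
theorem mem_span_starElt {κ : Vertex N} {B : Module.End ℂ (V N)} (hB : coeff κ B ∈ symm N) :
    B ∈ Submodule.span ℂ (starElt κ '' triples N) := by
  classical
  have hf : Function.FactorsThrough (coeff κ B) (profile κ) := by
    intro w w' h
    obtain ⟨π, rfl⟩ := exists_perm_of_profile_eq h
    exact (hB π w).symm
  obtain ⟨F, hF⟩ := (Function.factorsThrough_iff _).1 hf
  have : B = ∑ t ∈ Finset.univ.image (profile κ), F t • starElt κ t := by
    apply (coeff κ).injective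
    funext w
    rw [hF, map_sum, Finset.sum_apply, Finset.sum_eq_single (profile κ w)]
    · rw [map_smul, Pi.smul_apply, starElt, coeff_dualPrimIdem_mul, if_pos ⟨rfl, rfl, rfl⟩]
      simp
    · intro t _ ht
      rw [map_smul, Pi.smul_apply, starElt, coeff_dualPrimIdem_mul, if_neg, smul_zero]
      rintro ⟨h1, h2, h3⟩
      exact ht (Prod.ext h1.symm (Prod.ext h2.symm h3.symm))
    · intro h
      simp at h
  rw [this]
  refine Submodule.sum_mem _ fun t ht => Submodule.smul_mem _ _ (Submodule.subset_span ⟨t, ?_, rfl⟩)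
  obtain ⟨w, -, rfl⟩ := Finset.mem_image.1 ht
  exact profile_mem_triples κ w

theorem mem_T_iff {κ : Vertex N} {B : Module.End ℂ (V N)} : B ∈ T κ ↔ coeff κ B ∈ symm N := by
  refine ⟨coeff_mem_symm, fun h => ?_⟩
  have hle : Submodule.span ℂ (starElt κ '' triples N) ≤ Subalgebra.toSubmodule (T κ) := by
    rw [Submodule.span_le]
    rintro _ ⟨t, ht, rfl⟩
    exact starElt_mem_T κ ht
  exact hle (mem_span_starElt h)

theorem mem_span_elt {κ : Vertex N} {B : Module.End ℂ (V N)} (hB : B ∈ T κ) :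
    B ∈ Submodule.span ℂ (elt κ '' triples N) := by
  have h := Submodule.mem_map_of_mem (f := (fourierConj κ).toLinearMap)
    (mem_span_starElt (coeff_mem_symm (fourierConj_mem_T hB)))
  rw [Submodule.map_span, Set.image_image] at h
  simp only [AlgEquiv.toLinearMap_apply, fourierConj_fourierConj] at h
  rwa [Set.image_congr fun t ht => fourierConj_starElt κ ht] at h

theorem endT_ext {κ : Vertex N} {E : ℕ × ℕ × ℕ → Module.End ℂ (V N)}
    (hE : ∀ B ∈ T κ, B ∈ Submodule.span ℂ (E '' triples N)) {F F' : Module.End ℂ (T κ)}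
    (h : ∀ t ∈ triples N, ∃ ht : E t ∈ T κ, F ⟨_, ht⟩ = F' ⟨_, ht⟩) : F = F' := by
  refine LinearMap.ext fun B => ?_
  -- The locus of agreement is a subspace of $T$; its image in $\mathrm{End}(V)$ contains the
  -- spanning family.
  have hle : Submodule.span ℂ (E '' triples N)
      ≤ (LinearMap.eqLocus F F').map (Subalgebra.toSubmodule (T κ)).subtype := by
    rw [Submodule.span_le]
    rintro _ ⟨t, ht, rfl⟩
    obtain ⟨hm, he⟩ := h t ht
    exact ⟨⟨_, hm⟩, he, rfl⟩
  obtain ⟨C, hC, hCB⟩ := hle (hE B.1 B.2)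
  obtain rfl : C = B := Subtype.ext hCB
  exact hC

/-- The matrices of the elements of `T` are the symmetric tensors. -/
def symmEquivT (κ : Vertex N) : T κ ≃ₗ[ℂ] symm N where
  toFun B := ⟨coeff κ B, coeff_mem_symm B.2⟩
  map_add' B C := Subtype.ext (map_add (coeff κ) B.1 C.1)
  map_smul' c B := Subtype.ext (map_smul (coeff κ) c B.1)
  invFun f := ⟨(coeff κ).symm f, mem_T_iff.2 (by simp)⟩
  left_inv B := Subtype.ext (by simp)
  right_inv f := Subtype.ext (by simp)

/-! ### Transport of structure and the action on $T$ -/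

section transport

variable {U M : Type*} [AddCommGroup U] [Module ℂ U] [AddCommGroup M] [Module ℂ M]
  (ρ : sl4 →ₗ⁅ℂ⁆ Module.End ℂ M) (e : U ≃ₗ[ℂ] M)

/-- The module structure carried over from a representation by a linear equivalence. -/
abbrev transportLieRingModule : LieRingModule sl4 U where
  bracket x u := e.symm (ρ x (e u))
  add_lie x y u := by simp
  lie_add x u v := by simp
  leibniz_lie x y u := by
    simp [LieHom.map_lie, LieRing.of_associative_ring_bracket]

theorem transport_lie (x : sl4) (u : U) :
    letI := transportLieRingModule ρ e
    e ⁅x, u⁆ = ρ x (e u) :=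
  e.apply_symm_apply _

theorem transportLieModule :
    letI := transportLieRingModule ρ e
    LieModule ℂ sl4 U :=
  letI := transportLieRingModule ρ e
  { smul_lie := fun c x u => e.injective (by simp [transport_lie])
    lie_smul := fun c x u => e.injective (by simp [transport_lie]) }

end transport

/-- The representation of `𝔰𝔩₄(ℂ)` on `T`. -/
def repT (κ : Vertex N) (x : sl4) : Module.End ℂ (T κ) :=
  (symmEquivT κ).symm.toLinearMap ∘ₗ symmRep N x ∘ₗ (symmEquivT κ).toLinearMap

theorem symmEquivT_repT (κ : Vertex N) (x : sl4) (B : T κ) :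
    symmEquivT κ (repT κ x B) = symmRep N x (symmEquivT κ B) := by
  simp [repT]

theorem coeff_repT (κ : Vertex N) (x : sl4) (B : T κ) :
    coeff κ (repT κ x B : Module.End ℂ (V N)) = totalAct N x.1 (coeff κ (B : Module.End ℂ (V N))) :=
  congrArg Subtype.val (symmEquivT_repT κ x B)

theorem repT_elt (κ : Vertex N) {t : ℕ × ℕ × ℕ} (ht : t ∈ triples N) (k : Fin 3) :
    repT κ (genA k) ⟨elt κ t, elt_mem_T κ ht⟩
      = theta N (![t.1, t.2.1, t.2.2] k) • (⟨elt κ t, elt_mem_T κ ht⟩ : T κ) := by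
  apply Subtype.ext
  apply (coeff κ).injective
  rw [coeff_repT, SetLike.val_smul, map_smul]
  exact totalAct_genA_basis κ ht.1 ht.2.1 ht.2.2.1 k

theorem repT_starElt (κ : Vertex N) {t : ℕ × ℕ × ℕ} (ht : t ∈ triples N) (k : Fin 3) :
    repT κ (genAStar k) ⟨starElt κ t, starElt_mem_T κ ht⟩
      = theta N (![t.1, t.2.2, t.2.1] k) • (⟨starElt κ t, starElt_mem_T κ ht⟩ : T κ) := by
  apply Subtype.ext
  apply (coeff κ).injective
  rw [coeff_repT, SetLike.val_smul, map_smul]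
  exact totalAct_genAStar_basis κ t.1 t.2.1 t.2.2 k

theorem isCalA_repT (κ : Vertex N) : IsCalA κ fun k => repT κ (genA k) :=
  fun h i j ht => ⟨elt_mem_T (t := (h, i, j)) κ ht, repT_elt (t := (h, i, j)) κ ht⟩

theorem isCalAStar_repT (κ : Vertex N) : IsCalAStar κ fun k => repT κ (genAStar k) :=
  fun h i j ht => ⟨starElt_mem_T (t := (h, i, j)) κ ht, repT_starElt (t := (h, i, j)) κ ht⟩

theorem IsCalA.unique {κ : Vertex N} {𝒜 𝒜' : Fin 3 → Module.End ℂ (T κ)} (h : IsCalA κ 𝒜)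
    (h' : IsCalA κ 𝒜') : 𝒜 = 𝒜' := by
  funext k
  refine endT_ext (E := elt κ) (fun B hB => mem_span_elt hB) fun t ht => ?_
  obtain ⟨hm, he⟩ := h t.1 t.2.1 t.2.2 ht
  obtain ⟨_, he'⟩ := h' t.1 t.2.1 t.2.2 ht
  exact ⟨hm, (he k).trans (he' k).symm⟩

theorem IsCalAStar.unique {κ : Vertex N} {𝒜 𝒜' : Fin 3 → Module.End ℂ (T κ)}
    (h : IsCalAStar κ 𝒜) (h' : IsCalAStar κ 𝒜') : 𝒜 = 𝒜' := by
  funext k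
  refine endT_ext (E := starElt κ) (fun B hB => mem_span_starElt (coeff_mem_symm hB))
    fun t ht => ?_
  obtain ⟨hm, he⟩ := h t.1 t.2.1 t.2.2 ht
  obtain ⟨_, he'⟩ := h' t.1 t.2.1 t.2.2 ht
  exact ⟨hm, (he k).trans (he' k).symm⟩

end Hypercube

namespace Hypercube

variable {N : ℕ}

/-! ### Generation of $\mathfrak{sl}_4$ -/

theorem lie_genAStar_apply (k : Fin 3) (y : sl4) (a b : Fin 4) :
    (⁅genAStar k, y⁆ : sl4).1 a b
      = (sgn (signAStar k a) - sgn (signAStar k b)) * y.1 a b := by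
  have h : (genAStar k).1 = Matrix.diagonal fun a => sgn (signAStar k a) := by
    ext i j
    fin_cases k <;> fin_cases i <;> fin_cases j <;> simp [genAStar, signAStar, Matrix.diagonal]
  change ((genAStar k).1 * y.1 - y.1 * (genAStar k).1) a b = _
  rw [h, Matrix.sub_apply, Matrix.diagonal_mul, Matrix.mul_diagonal]
  ring

theorem genA_apply (k : Fin 3) (a b : Fin 4) :
    (genA k).1 a b = if b = swapA k a then 1 else 0 := by
  fin_cases k <;> fin_cases a <;> fin_cases b <;> simp [genA, swapA]

theorem genAStar_apply (k : Fin 3) (a b : Fin 4) :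
    (genAStar k).1 a b = if a = b then sgn (signAStar k a) else 0 := by
  fin_cases k <;> fin_cases a <;> fin_cases b <;> simp [genAStar, signAStar]

section

attribute [local instance] LieRing.ofAssociativeRing

/-- The matrix positions split into the diagonal and the supports of the three $A_k$. On each, the
row functions $1$ and the three sign functions are the characters of the Klein four-group, and
Fourier inversion gives the factor $1/4$. A bracket with $A^*_l$, $l\ne k$, yields $2$ times a sign
function and the double bracket $4$ times the remaining one, hence $1/8$ and $1/16$; the bracket
with $l=k$ vanishes. -/
theorem sl4_decomposition (x : sl4) :
    x = ∑ k, ((1 / 4 * ∑ a, x.1 a (swapA k a)) • genA k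
      + ∑ l, (1 / 8 * ∑ a, sgn (signAStar l a) * x.1 a (swapA k a)) • ⁅genAStar l, genA k⁆
      + (1 / 16 * ∑ a, sgn (signAStar k a) * x.1 a (swapA k a)) •
          ⁅genAStar (k + 1), ⁅genAStar (k + 2), genA k⁆⁆
      + (1 / 4 * ∑ a, sgn (signAStar k a) * x.1 a a) • genAStar k) := by
  have htr : x.1 0 0 + x.1 1 1 + x.1 2 2 + x.1 3 3 = 0 := by
    have h : Matrix.trace x.1 = 0 := x.2
    rwa [Matrix.trace, Fin.sum_univ_four] at h
  apply Subtype.ext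
  ext a b
  let entry : sl4 →ₗ[ℂ] ℂ := Matrix.entryLinearMap ℂ ℂ a b ∘ₗ
    (LieAlgebra.SpecialLinear.sl (Fin 4) ℂ).toSubmodule.subtype
  have key : ∀ y : sl4, y.1 a b = entry y := fun _ => rfl
  rw [key (∑ k, _)]
  simp only [map_sum, map_add, map_smul, smul_eq_mul]
  simp only [← key, lie_genAStar_apply, genA_apply, genAStar_apply, Fin.sum_univ_three,
    Fin.sum_univ_four]
  clear key entry
  fin_cases a <;> fin_cases b <;> simp [swapA, signAStar] <;>
    -- On the diagonal the coefficient of the trivial character is the trace, which vanishes.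
    first | ring1 | linear_combination (1 / 4 : ℂ) * htr

end

theorem mem_of_generators_mem {S : LieSubalgebra ℂ sl4} (hA : ∀ k, genA k ∈ S)
    (hs : ∀ k, genAStar k ∈ S) (x : sl4) : x ∈ S := by
  rw [sl4_decomposition x]
  refine sum_mem fun k _ => add_mem (add_mem (add_mem ?_ (sum_mem fun l _ => ?_)) ?_) ?_
  · exact S.smul_mem _ (hA k)
  · exact S.smul_mem _ (S.lie_mem (hs l) (hA k))
  · exact S.smul_mem _ (S.lie_mem (hs _) (S.lie_mem (hs _) (hA k)))
  · exact S.smul_mem _ (hs k)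

/-- A linear map that commutes with the generators of `𝔰𝔩₄(ℂ)` commutes with `𝔰𝔩₄(ℂ)`. -/
theorem map_lie_of_generators {U M : Type*} [AddCommGroup U] [Module ℂ U] [AddCommGroup M]
    [Module ℂ M] [LieRingModule sl4 U] [LieModule ℂ sl4 U] [LieRingModule sl4 M]
    [LieModule ℂ sl4 M] (e : U →ₗ[ℂ] M) (hA : ∀ k u, e ⁅genA k, u⁆ = ⁅genA k, e u⁆)
    (hs : ∀ k u, e ⁅genAStar k, u⁆ = ⁅genAStar k, e u⁆) (x : sl4) (u : U) :
    e ⁅x, u⁆ = ⁅x, e u⁆ := by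
  let S : LieSubalgebra ℂ sl4 :=
    { carrier := {x | ∀ u, e ⁅x, u⁆ = ⁅x, e u⁆}
      zero_mem' := fun u => by simp
      add_mem' := fun {x y} hx hy u => by rw [add_lie, add_lie, map_add, hx u, hy u]
      smul_mem' := fun c x hx u => by rw [smul_lie, smul_lie, map_smul, hx u]
      lie_mem' := fun {x y} hx hy u => by
        rw [lie_lie, lie_lie, map_sub, hx, hy, hy, hx] }
  exact mem_of_generators_mem (S := S) hA hs x u

/-! ### The module $\mathrm{Fix}(G)$ and the map $\varepsilon$ -/

section basis

variable {P M : Type*} [AddCommGroup M] [Module ℂ M] (b : Module.Basis P ℂ M)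

theorem repr_of_permutes {L : Module.End ℂ M} {e : Equiv.Perm P} (h : ∀ p, L (b p) = b (e p))
    (v : M) (q : P) : b.repr (L v) q = b.repr v (e.symm q) := by
  classical
  have : (Finsupp.lapply q ∘ₗ b.repr.toLinearMap) ∘ₗ L
      = Finsupp.lapply (e.symm q) ∘ₗ b.repr.toLinearMap := b.ext fun p => by
    simp [h, Finsupp.single_apply, Equiv.eq_symm_apply]
  exact LinearMap.congr_fun this v

theorem repr_of_scales {L : Module.End ℂ M} {c : P → ℂ} (h : ∀ p, L (b p) = c p • b p)
    (v : M) (q : P) : b.repr (L v) q = c q * b.repr v q := by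
  classical
  have : (Finsupp.lapply q ∘ₗ b.repr.toLinearMap) ∘ₗ L
      = c q • (Finsupp.lapply q ∘ₗ b.repr.toLinearMap) := b.ext fun p => by
    by_cases hp : p = q
    · subst hp; simp [h]
    · simp [h, hp]
  exact LinearMap.congr_fun this v

theorem repr_of_sum_permutes {ι : Type*} [Fintype ι] {L : Module.End ℂ M}
    {e : ι → Equiv.Perm P} (h : ∀ p, L (b p) = ∑ i, b (e i p)) (v : M) (q : P) :
    b.repr (L v) q = ∑ i, b.repr v ((e i).symm q) := by
  have : L = ∑ i, b.constr ℂ fun p => b (e i p) := b.ext fun p => by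
    simp [h]
  rw [this, LinearMap.sum_apply, map_sum, Finsupp.finsetSum_apply]
  exact Finset.sum_congr rfl fun i _ =>
    repr_of_permutes b (fun p => b.constr_basis ℂ _ p) v q

end basis

/-- The change of the coordinate `i`, as a permutation of `X`. -/
def flipPerm (i : Fin N) : Equiv.Perm (Vertex N) := Function.Involutive.toPerm _ (flip_flip i)

theorem repr_adj3_zero (v : V3 N) (x y z : Vertex N) :
    (basis3 N).repr (adj3 N 0 v) (x, y, z) = ∑ i, (basis3 N).repr v (flip i x, y, z) := by
  classical
  refine repr_of_sum_permutes (basis3 N)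
    (e := fun i => (flipPerm i).prodCongr (Equiv.refl _)) (fun p => ?_) v (x, y, z)
  exact ((basis3 N).constr_basis ℂ _ p).trans (sum_adj p.1 fun ξ => basis3 N (ξ, p.2.1, p.2.2))

theorem repr_adj3_one (v : V3 N) (x y z : Vertex N) :
    (basis3 N).repr (adj3 N 1 v) (x, y, z) = ∑ i, (basis3 N).repr v (x, flip i y, z) := by
  classical
  refine repr_of_sum_permutes (basis3 N)
    (e := fun i => (Equiv.refl _).prodCongr ((flipPerm i).prodCongr (Equiv.refl _)))
    (fun p => ?_) v (x, y, z)
  exact ((basis3 N).constr_basis ℂ _ p).trans (sum_adj p.2.1 fun ξ => basis3 N (p.1, ξ, p.2.2))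

theorem repr_adj3_two (v : V3 N) (x y z : Vertex N) :
    (basis3 N).repr (adj3 N 2 v) (x, y, z) = ∑ i, (basis3 N).repr v (x, y, flip i z) := by
  classical
  refine repr_of_sum_permutes (basis3 N)
    (e := fun i => (Equiv.refl _).prodCongr ((Equiv.refl _).prodCongr (flipPerm i)))
    (fun p => ?_) v (x, y, z)
  exact ((basis3 N).constr_basis ℂ _ p).trans (sum_adj p.2.2 fun ξ => basis3 N (p.1, p.2.1, ξ))

theorem repr_dualAdj3_zero (v : V3 N) (x y z : Vertex N) :
    (basis3 N).repr (dualAdj3 N 0 v) (x, y, z)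
      = theta N (dist y z) * (basis3 N).repr v (x, y, z) :=
  repr_of_scales (basis3 N) (c := fun p => theta N (dist p.2.1 p.2.2))
    (fun p => (basis3 N).constr_basis ℂ _ p) v (x, y, z)

theorem repr_dualAdj3_one (v : V3 N) (x y z : Vertex N) :
    (basis3 N).repr (dualAdj3 N 1 v) (x, y, z)
      = theta N (dist z x) * (basis3 N).repr v (x, y, z) :=
  repr_of_scales (basis3 N) (c := fun p => theta N (dist p.2.2 p.1))
    (fun p => (basis3 N).constr_basis ℂ _ p) v (x, y, z)

theorem repr_dualAdj3_two (v : V3 N) (x y z : Vertex N) :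
    (basis3 N).repr (dualAdj3 N 2 v) (x, y, z)
      = theta N (dist x y) * (basis3 N).repr v (x, y, z) :=
  repr_of_scales (basis3 N) (c := fun p => theta N (dist p.1 p.2.1))
    (fun p => (basis3 N).constr_basis ℂ _ p) v (x, y, z)

theorem repr_actV3 (g : G N) (v : V3 N) (x y z : Vertex N) :
    (basis3 N).repr (actV3 g v) (x, y, z)
      = (basis3 N).repr v (g.symm x, g.symm y, g.symm z) := by
  refine repr_of_permutes (basis3 N)
    (e := g.toEquiv.prodCongr (g.toEquiv.prodCongr g.toEquiv)) (fun p => ?_) v (x, y, z)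
  rw [basis3_apply p.1 p.2.1 p.2.2, actV3, TensorProduct.map_tmul, TensorProduct.map_tmul,
    actV_vec, actV_vec, actV_vec, ← basis3_apply]
  rfl

theorem mem_FixG_iff {v : V3 N} : v ∈ FixG N ↔ ∀ (g : G N) (x y z : Vertex N),
    (basis3 N).repr v (g x, g y, g z) = (basis3 N).repr v (x, y, z) := by
  constructor
  · intro h g x y z
    conv_lhs => rw [← h g]
    rw [repr_actV3]
    simp only [RelIso.symm_apply_apply]
  · intro h g
    apply (basis3 N).repr.injective
    ext ⟨x, y, z⟩
    rw [repr_actV3, ← h g]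
    simp only [RelIso.apply_symm_apply]

theorem adj3_mem_FixG (k : Fin 3) {v : V3 N} (hv : v ∈ FixG N) : adj3 N k v ∈ FixG N := by
  rw [mem_FixG_iff] at hv ⊢
  intro g x y z
  match k with
  | 0 =>
    rw [repr_adj3_zero, repr_adj3_zero,
      sum_adj_iso g x fun ξ => (basis3 N).repr v (ξ, g y, g z)]
    simp only [hv g]
  | 1 =>
    rw [repr_adj3_one, repr_adj3_one,
      sum_adj_iso g y fun ξ => (basis3 N).repr v (g x, ξ, g z)]
    simp only [hv g]
  | 2 =>
    rw [repr_adj3_two, repr_adj3_two,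
      sum_adj_iso g z fun ξ => (basis3 N).repr v (g x, g y, ξ)]
    simp only [hv g]

theorem dualAdj3_mem_FixG (k : Fin 3) {v : V3 N} (hv : v ∈ FixG N) :
    dualAdj3 N k v ∈ FixG N := by
  rw [mem_FixG_iff] at hv ⊢
  intro g x y z
  match k with
  | 0 => rw [repr_dualAdj3_zero, repr_dualAdj3_zero, dist_iso, hv g]
  | 1 => rw [repr_dualAdj3_one, repr_dualAdj3_one, dist_iso, hv g]
  | 2 => rw [repr_dualAdj3_two, repr_dualAdj3_two, dist_iso, hv g]

/-- The scalar `2^{N/2}`. -/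
def epsScalar (N : ℕ) : ℂ := (((2 : ℝ) ^ ((N : ℝ) / 2) : ℝ) : ℂ)

/-- The normalisation of $\varepsilon$ matters only through being nonzero. -/
theorem epsScalar_ne_zero : epsScalar N ≠ 0 :=
  Complex.ofReal_ne_zero.2 (Real.rpow_pos_of_pos two_pos _).ne'

theorem coeff_eps (κ : Vertex N) (v : V3 N) (w : Fin N → Fin 4) :
    coeff κ (eps κ v) w = epsScalar N * (basis3 N).repr v (κ, left κ w, right κ w) := by
  classical
  have : (LinearMap.proj w ∘ₗ (coeff κ).toLinearMap) ∘ₗ eps κ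
      = epsScalar N • (Finsupp.lapply (κ, left κ w, right κ w) ∘ₗ (basis3 N).repr.toLinearMap) := by
    refine (basis3 N).ext fun p => ?_
    simp only [LinearMap.comp_apply, eps, Module.Basis.constr_basis, LinearMap.smul_apply,
      LinearEquiv.coe_coe, Module.Basis.repr_self, Finsupp.lapply_apply, LinearMap.proj_apply]
    obtain ⟨x, y, z⟩ := p
    by_cases hx : x = κ
    · rw [if_pos hx, map_smul, Pi.smul_apply, coeff_apply, matUnit_apply, vec_apply, vec_apply,
        Finsupp.single_apply, ← epsScalar]
      congr 1
      rw [ite_zero_mul_ite_zero, mul_one]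
      exact if_congr ⟨fun h => Prod.ext hx (Prod.ext h.2.symm h.1), fun h => by simp_all⟩ rfl rfl
    · simp [hx]
  exact LinearMap.congr_fun this v

theorem totalAct_coeff_eps_genA {κ : Vertex N} {v : V3 N} (hv : v ∈ FixG N) (k : Fin 3) :
    totalAct N (genA k).1 (coeff κ (eps κ v)) = coeff κ (eps κ (adj3 N k v)) := by
  funext w
  rw [totalAct_genA]
  simp only [coeff_eps, ← Finset.mul_sum]
  congr 1
  match k with
  | 0 =>
    rw [repr_adj3_zero]
    refine Finset.sum_congr rfl fun i _ => ?_
    -- By invariance under a coordinate translation, flipping the last two vertices has the same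
    -- effect as flipping the first.
    rw [left_swap_zero, right_swap_zero, ← mem_FixG_iff.1 hv (translate (flip i 1))]
    simp only [← flip_eq_translate, flip_flip]
  | 1 =>
    rw [repr_adj3_one]
    simp only [left_swap_one, right_swap_one]
  | 2 =>
    rw [repr_adj3_two]
    simp only [left_swap_two, right_swap_two]

theorem totalAct_coeff_eps_genAStar (κ : Vertex N) (v : V3 N) (k : Fin 3) :
    totalAct N (genAStar k).1 (coeff κ (eps κ v)) = coeff κ (eps κ (dualAdj3 N k v)) := by
  funext w
  rw [totalAct_genAStar, coeff_eps, coeff_eps, mul_left_comm]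
  congr 1
  match k with
  | 0 => rw [repr_dualAdj3_zero, sum_sign_zero κ]
  | 1 => rw [repr_dualAdj3_one, sum_sign_one κ]
  | 2 => rw [repr_dualAdj3_two, sum_sign_two κ, dist, SimpleGraph.dist_comm]

theorem eps_mem_T {κ : Vertex N} {v : V3 N} (hv : v ∈ FixG N) : eps κ v ∈ T κ := by
  rw [mem_T_iff]
  intro π w
  have := mem_FixG_iff.1 hv (permute κ π) κ (left κ w) (right κ w)
  rw [permute_base, permute_left, permute_right] at this
  rw [coeff_eps, coeff_eps, this]

/-- Translation by `κ * x` moves the first vertex to `κ`, where $\varepsilon$ reads off the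
coefficient. -/
theorem eps_injOn {κ : Vertex N} {v v' : V3 N} (hv : v ∈ FixG N) (hv' : v' ∈ FixG N)
    (h : eps κ v = eps κ v') : v = v' := by
  apply (basis3 N).repr.injective
  ext ⟨x, y, z⟩
  rw [← mem_FixG_iff.1 hv (translate (κ * x)), ← mem_FixG_iff.1 hv' (translate (κ * x))]
  have h1 := congrFun (congrArg (coeff κ) h) (word κ (κ * x * y) (κ * x * z))
  rw [coeff_eps, coeff_eps, left_word, right_word] at h1
  simpa [mul_assoc, vertex_mul_self] using mul_left_cancel₀ epsScalar_ne_zero h1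

/-- The coefficients at first vertex `κ` are prescribed by $B$ and extended by translation. The
profile of the translated pair consists of the mutual distances of $x,y,z$, so every automorphism
only permutes the word, and symmetry of the matrix of $B$ gives invariance. -/
theorem exists_eps_eq {κ : Vertex N} {B : Module.End ℂ (V N)} (hB : B ∈ T κ) :
    ∃ v ∈ FixG N, eps κ v = B := by
  have hc (x y : Vertex N) : dist (κ * x * y) κ = dist y x := by
    rw [← dist_translate (κ * x)]
    congr 1
    · rw [← mul_assoc, vertex_mul_self, one_mul]
    · rw [mul_right_comm, vertex_mul_self, one_mul]
  let v : V3 N := (basis3 N).equivFun.symm fun p =>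
    (epsScalar N)⁻¹ * coeff κ B (word κ (κ * p.1 * p.2.1) (κ * p.1 * p.2.2))
  have hv (x y z : Vertex N) : (basis3 N).repr v (x, y, z)
      = (epsScalar N)⁻¹ * coeff κ B (word κ (κ * x * y) (κ * x * z)) := by
    rw [← (basis3 N).equivFun_apply, LinearEquiv.apply_symm_apply]
  refine ⟨v, mem_FixG_iff.2 fun g x y z => ?_, ?_⟩
  · rw [hv, hv]
    congr 1
    obtain ⟨π, hπ⟩ : ∃ π : Equiv.Perm (Fin N), word κ (κ * x * y) (κ * x * z) ∘ π
        = word κ (κ * g x * g y) (κ * g x * g z) := by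
      apply exists_perm_of_profile_eq (κ := κ)
      simp only [profile, left_word, right_word, hc, dist_translate, dist_iso]
    rw [← hπ]
    exact coeff_mem_symm hB π _
  · apply (coeff κ).injective
    funext w
    rw [coeff_eps, hv, vertex_mul_self, one_mul, one_mul, word_left_right,
      mul_inv_cancel_left₀ epsScalar_ne_zero]

/-- The restriction of `ε` to `Fix(G)`, as a linear map to `T`. -/
def epsHom (κ : Vertex N) : FixG N →ₗ[ℂ] T κ where
  toFun v := ⟨eps κ v, eps_mem_T v.2⟩
  map_add' v v' := Subtype.ext (map_add (eps κ) (v : V3 N) (v' : V3 N))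
  map_smul' c v := Subtype.ext (map_smul (eps κ) c (v : V3 N))

theorem epsHom_bijective (κ : Vertex N) : Function.Bijective (epsHom κ) := by
  constructor
  · intro v v' h
    exact Subtype.ext (eps_injOn v.2 v'.2 (congrArg Subtype.val h))
  · intro B
    obtain ⟨v, hv, he⟩ := exists_eps_eq B.2
    exact ⟨⟨v, hv⟩, Subtype.ext he⟩

/-- The restriction of `ε` to `Fix(G)`, as a linear equivalence onto `T`. -/
def epsEquiv (κ : Vertex N) : FixG N ≃ₗ[ℂ] T κ :=
  LinearEquiv.ofBijective (epsHom κ) (epsHom_bijective κ)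

theorem repT_epsEquiv_genA (κ : Vertex N) (k : Fin 3) (v : FixG N) :
    repT κ (genA k) (epsEquiv κ v) = epsEquiv κ ⟨adj3 N k v, adj3_mem_FixG k v.2⟩ := by
  apply Subtype.ext
  apply (coeff κ).injective
  rw [coeff_repT]
  exact totalAct_coeff_eps_genA v.2 k

theorem repT_epsEquiv_genAStar (κ : Vertex N) (k : Fin 3) (v : FixG N) :
    repT κ (genAStar k) (epsEquiv κ v)
      = epsEquiv κ ⟨dualAdj3 N k v, dualAdj3_mem_FixG k v.2⟩ := by
  apply Subtype.ext
  apply (coeff κ).injective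
  rw [coeff_repT]
  exact totalAct_coeff_eps_genAStar κ v k

theorem repT_eq_of_lie {κ : Vertex N} {𝒜 𝒜s : Fin 3 → Module.End ℂ (T κ)} (hA : IsCalA κ 𝒜)
    (hs : IsCalAStar κ 𝒜s) (k : Fin 3) :
    repT κ (genA k) = 𝒜 k ∧ repT κ (genAStar k) = 𝒜s k :=
  ⟨congrFun ((isCalA_repT κ).unique hA) k, congrFun ((isCalAStar_repT κ).unique hs) k⟩

theorem exists_lieModule_T (κ : Vertex N) :
    ∃ (_ : LieRingModule sl4 (T κ)) (_ : LieModule ℂ sl4 (T κ)),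
      ∀ (x : sl4) (B : T κ), ⁅x, B⁆ = repT κ x B := by
  let _ := transportLieRingModule (U := T κ) (symmRep N) (symmEquivT κ)
  have h := transportLieModule (U := T κ) (symmRep N) (symmEquivT κ)
  exact ⟨inferInstance, h, fun _ _ => rfl⟩

theorem exists_lieModule_FixG (N : ℕ) :
    ∃ (_ : LieRingModule sl4 (FixG N)) (_ : LieModule ℂ sl4 (FixG N)),
      ∀ (k : Fin 3) (v : FixG N),
        ((⁅genA k, v⁆ : FixG N) : V3 N) = adj3 N k v ∧
        ((⁅genAStar k, v⁆ : FixG N) : V3 N) = dualAdj3 N k v := by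
  -- Any base vertex serves: the resulting action of the generators is described without it.
  let κ : Vertex N := 1
  let e : FixG N ≃ₗ[ℂ] symm N := (epsEquiv κ).trans (symmEquivT κ)
  let _ := transportLieRingModule (U := FixG N) (symmRep N) e
  have h := transportLieModule (U := FixG N) (symmRep N) e
  refine ⟨inferInstance, h, fun k v => ?_⟩
  have hA : ⁅genA k, v⁆ = ⟨adj3 N k v, adj3_mem_FixG k v.2⟩ := by
    apply e.injective
    refine (transport_lie (U := FixG N) (symmRep N) e _ _).trans ?_
    exact (symmEquivT_repT κ _ _).symm.trans (congrArg (symmEquivT κ) (repT_epsEquiv_genA κ k v))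
  have hs : ⁅genAStar k, v⁆ = ⟨dualAdj3 N k v, dualAdj3_mem_FixG k v.2⟩ := by
    apply e.injective
    refine (transport_lie (U := FixG N) (symmRep N) e _ _).trans ?_
    exact (symmEquivT_repT κ _ _).symm.trans
      (congrArg (symmEquivT κ) (repT_epsEquiv_genAStar κ k v))
  exact ⟨congrArg Subtype.val hA, congrArg Subtype.val hs⟩

end Hypercube

end

/-! ### The main theorem -/

theorem mainTheorem6 (N : ℕ) (κ : Hypercube.Vertex N) :
    (∃! 𝒜 : Fin 3 → Module.End ℂ (Hypercube.T κ), Hypercube.IsCalA κ 𝒜) ∧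
    (∃! 𝒜s : Fin 3 → Module.End ℂ (Hypercube.T κ), Hypercube.IsCalAStar κ 𝒜s) ∧
    (∃ (_ : LieRingModule Hypercube.sl4 (Hypercube.FixG N))
       (_ : LieModule ℂ Hypercube.sl4 (Hypercube.FixG N)),
      ∀ (k : Fin 3) (v : Hypercube.FixG N),
        ((⁅Hypercube.genA k, v⁆ : Hypercube.FixG N) : Hypercube.V3 N) = Hypercube.adj3 N k v ∧
        ((⁅Hypercube.genAStar k, v⁆ : Hypercube.FixG N) : Hypercube.V3 N)
          = Hypercube.dualAdj3 N k v) ∧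
    ∀ 𝒜 𝒜s : Fin 3 → Module.End ℂ (Hypercube.T κ),
      Hypercube.IsCalA κ 𝒜 → Hypercube.IsCalAStar κ 𝒜s →
      (∃ (_ : LieRingModule Hypercube.sl4 (Hypercube.T κ))
         (_ : LieModule ℂ Hypercube.sl4 (Hypercube.T κ)),
        ∀ (k : Fin 3) (B : Hypercube.T κ),
          ⁅Hypercube.genA k, B⁆ = 𝒜 k B ∧ ⁅Hypercube.genAStar k, B⁆ = 𝒜s k B) ∧
      ∀ [LieRingModule Hypercube.sl4 (Hypercube.FixG N)]
        [LieModule ℂ Hypercube.sl4 (Hypercube.FixG N)]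
        [LieRingModule Hypercube.sl4 (Hypercube.T κ)]
        [LieModule ℂ Hypercube.sl4 (Hypercube.T κ)],
        (∀ (k : Fin 3) (v : Hypercube.FixG N),
          ((⁅Hypercube.genA k, v⁆ : Hypercube.FixG N) : Hypercube.V3 N) = Hypercube.adj3 N k v ∧
          ((⁅Hypercube.genAStar k, v⁆ : Hypercube.FixG N) : Hypercube.V3 N)
            = Hypercube.dualAdj3 N k v) →
        (∀ (k : Fin 3) (B : Hypercube.T κ),
          ⁅Hypercube.genA k, B⁆ = 𝒜 k B ∧ ⁅Hypercube.genAStar k, B⁆ = 𝒜s k B) →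
        ∃ e : Hypercube.FixG N ≃ₗ⁅ℂ, Hypercube.sl4⁆ Hypercube.T κ,
          ∀ v : Hypercube.FixG N,
            ((e v : Hypercube.T κ) : Module.End ℂ (Hypercube.V N)) = Hypercube.eps κ v := by
  refine ⟨⟨_, Hypercube.isCalA_repT κ, fun _ h => h.unique (Hypercube.isCalA_repT κ)⟩,
    ⟨_, Hypercube.isCalAStar_repT κ, fun _ h => h.unique (Hypercube.isCalAStar_repT κ)⟩,
    Hypercube.exists_lieModule_FixG N, fun 𝒜 𝒜s hA hs => ⟨?_, ?_⟩⟩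
  · obtain ⟨i₁, i₂, h⟩ := Hypercube.exists_lieModule_T κ
    refine ⟨i₁, i₂, fun k B => ?_⟩
    rw [h, h, (Hypercube.repT_eq_of_lie hA hs k).1, (Hypercube.repT_eq_of_lie hA hs k).2]
    exact ⟨rfl, rfl⟩
  · intro _ _ _ _ hFix hT
    have h₁ (k : Fin 3) (v : Hypercube.FixG N) : Hypercube.epsEquiv κ ⁅Hypercube.genA k, v⁆
        = ⁅Hypercube.genA k, Hypercube.epsEquiv κ v⁆ := by
      rw [(hT k _).1, ← (Hypercube.repT_eq_of_lie hA hs k).1, Hypercube.repT_epsEquiv_genA]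
      exact congrArg _ (Subtype.ext (hFix k v).1)
    have h₂ (k : Fin 3) (v : Hypercube.FixG N) : Hypercube.epsEquiv κ ⁅Hypercube.genAStar k, v⁆
        = ⁅Hypercube.genAStar k, Hypercube.epsEquiv κ v⁆ := by
      rw [(hT k _).2, ← (Hypercube.repT_eq_of_lie hA hs k).2, Hypercube.repT_epsEquiv_genAStar]
      exact congrArg _ (Subtype.ext (hFix k v).2)
    -- Both module structures are arbitrary and known only on the six generators; generation of
    -- $\mathfrak{sl}_4$ extends the intertwining to every element.
    have h := Hypercube.map_lie_of_generators (U := Hypercube.FixG N) (M := Hypercube.T κ)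
      (Hypercube.epsEquiv κ).toLinearMap h₁ h₂
    exact ⟨{ Hypercube.epsEquiv κ with map_lie' := fun {x v} => h x v }, fun v => rfl⟩
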